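/- Let $R$ be a $3$-dimensional regular local ring with maximal ideal $\mathfrak m = (x,y,z)R$, and let $I$ be the ideal of $R$ generated by the maximal minors of the matrix $$\begin{pmatrix} x & y & z \\ y & z & x^2 \end{pmatrix}.$$ For $n \ge 1$ let $I^{(n)} = \bigcap_{\mathfrak p} (I^nR_{\mathfrak p} \cap R)$ denote the $n$-th symbolic power of $I$, where $\mathfrak p$ runs over the minimal primes of $I$, and let $\ell_R$ denote length. Then for every $n \ge 1$, with $q = \lfloor n/2 \rfloor$, $$\ell_R\bigl(I^{(n)}/I^n\bigr) = \sum_{k=1}^{q} \binom{n-2k+2}{2}.$$ In closed form, $$\ell_R\bigl(I^{(n)}/I^n\bigr) = \begin{cases} \dfrac12\dbinom{n+2}{3} - \dfrac14\dbinom{n+1}{2} - \dfrac18 n & \text{if } n \text{ is even},\\[2ex] \dfrac12\dbinom{n+2}{3} - \dfrac14\dbinom{n+1}{2} - \dfrac18 n - \dfrac18 & \text{if } n \text{ is odd}. \end{cases}$$ As a consequence, the $\epsilon$-multiplicity $\epsilon(I) := \lim_{n\to\infty} \dfrac{3!}{n^3}\,\ell_R\bigl(I^{(n)}/I^n\bigr)$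 of $I$ exists and equals $\dfrac12$. -/

import Mathlib

open Filter Topology

/-- The ideal generated by the maximal minors of a `2 × 3` matrix, i.e. by the determinants of
the `2 × 2` submatrices obtained by choosing two columns, in increasing order. -/
def maximalMinorsIdeal {R : Type*} [CommRing R] (M : Matrix (Fin 2) (Fin 3) R) : Ideal R :=
  Ideal.span (Set.range fun e : Fin 2 ↪o Fin 3 => (M.submatrix id e).det)

/-- The `n`-th symbolic power `I⁽ⁿ⁾ = ⋂_{𝔭 ∈ Min(R/I)} (Iⁿ R_𝔭 ∩ R)`, where `𝔭` runs over the
minimal primes of `I` and `J ∩ R` is the preimage of `J` under `R → R_𝔭`. -/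
def symbolicPower {R : Type*} [CommRing R] (I : Ideal R) (n : ℕ) : Ideal R :=
  ⨅ p : {p : PrimeSpectrum R // p.asIdeal ∈ I.minimalPrimes},
    ((I ^ n).map (algebraMap R (Localization.AtPrime p.1.asIdeal))).comap
      (algebraMap R (Localization.AtPrime p.1.asIdeal))

/-- `Iⁿ ⊆ I⁽ⁿ⁾`, so that the quotient `I⁽ⁿ⁾ / Iⁿ` makes sense. -/
theorem pow_le_symbolicPower {R : Type*} [CommRing R] (I : Ideal R) (n : ℕ) :
    I ^ n ≤ symbolicPower I n :=
  le_iInf fun _ => Ideal.le_comap_map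

/-- The length `ℓ_R(I⁽ⁿ⁾ / Iⁿ)`, with value `⊤` if the module does not have finite length. -/
noncomputable def symbolicQuotientLength {R : Type*} [CommRing R] (I : Ideal R) (n : ℕ) : ℕ∞ :=
  Module.length R (↥(symbolicPower I n) ⧸ (I ^ n).submoduleOf (symbolicPower I n))

/-- For an ideal `I` of a three-dimensional local ring: the lengths `ℓ_R(I⁽ⁿ⁾ / Iⁿ)`, `n ≥ 1`,
are finite, and the limit `lim_{n → ∞} (3! / n³) · ℓ_R(I⁽ⁿ⁾ / Iⁿ)` defining the
`ε`-multiplicity of `I` exists and equals `e`. -/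
def HasEpsilonMultiplicity {R : Type*} [CommRing R] (I : Ideal R) (e : ℝ) : Prop :=
  (∀ n : ℕ, 1 ≤ n → symbolicQuotientLength I n ≠ ⊤) ∧
    Tendsto (fun n : ℕ =>
      ((Nat.factorial 3 : ℕ) : ℝ) / (n : ℝ) ^ 3 * ((symbolicQuotientLength I n).toNat : ℝ))
      atTop (𝓝 e)

/-! Write `a`, `b`, `c` for the minors `xz - y²`, `x³ - yz`, `yx² - z²`, `d` for `curveElt`, and `Sₙ
= Iⁿ + d Sₙ₋₂` for `curveSymbolic`. Everything rests on `xd = b² - ac`, `yd = bc + xa²`, `zd = c² +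
xab`, which give `𝔪d ⊆ I²`.

Symbolic powers: `d` lies in `I⁽²⁾` because `xd ∈ I²` and `x` avoids the minimal primes of `I`.
Conversely, modulo `d` the identities give `I² = aI`, so elements of `Sₙ` have a normal form from
which one sees that `x` is a nonzerodivisor modulo `Sₙ` (`exists_mul_eq_of_mem_curveSymbolic`).
Since `𝔪` is the only prime containing `I` and `x`, this forces `I⁽ⁿ⁾ = Sₙ`.

Lengths: multiplication by `d` maps `Sₙ` onto `Sₙ₊₂ / Iⁿ⁺²` with kernel `𝔪Iⁿ`. Indeed the leading
forms `XZ - Y²`, `-YZ`, `-Z²` of the minors are algebraically independent and that of `d` is `Z³`.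
So for `r ∈ Iⁿ` outside `𝔪Iⁿ` the product `dr` has order exactly `2n + 3`, whereas `Iⁿ⁺² ⊆ 𝔪²ⁿ⁺⁴`.
The same independence shows that `Iⁿ / 𝔪Iⁿ` has length `(n + 2).choose 2`, whence the recursion
`ℓ(Sₙ₊₂ / Iⁿ⁺²) = (n + 2).choose 2 + ℓ(Sₙ / Iⁿ)`. -/

section RegularParameters

/-! ### Regular parameters: primality by counting dimensions. -/

variable {R : Type*} [CommRing R]

/-- A lower bound for the dimension of `R ⧸ 𝔞` is attained by a prime containing `𝔞`. -/
theorem exists_isPrime_le_ringKrullDim_quotient {𝔞 : Ideal R} {n : ℕ}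
    (h : (n : WithBot ℕ∞) ≤ ringKrullDim (R ⧸ 𝔞)) :
    ∃ q : Ideal R, q.IsPrime ∧ 𝔞 ≤ q ∧ (n : WithBot ℕ∞) ≤ ringKrullDim (R ⧸ q) := by
  rw [ringKrullDim_quotient, Order.le_krullDim_iff] at h
  obtain ⟨l, hl⟩ := h
  refine ⟨l.head.1.asIdeal, l.head.1.isPrime, l.head.2, ?_⟩
  rw [ringKrullDim_quotient, Order.le_krullDim_iff]
  refine ⟨⟨l.length, fun i => ⟨(l i).1, ?_⟩, fun i => l.step i⟩, hl⟩
  exact l.head_le i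

theorem ringKrullDim_quotient_sup_span_add_one_le {P : Ideal R} (hP : P.IsPrime) {r : R}
    (hr : r ∉ P) : ringKrullDim (R ⧸ P ⊔ Ideal.span {r}) + 1 ≤ ringKrullDim (R ⧸ P) := by
  have h := ringKrullDim_quotient_succ_le_of_nonZeroDivisor (r := Ideal.Quotient.mk P r)
    (mem_nonZeroDivisors_of_ne_zero (by rwa [Ne, Ideal.Quotient.eq_zero_iff_mem]))
  rwa [← Set.image_singleton, ← Ideal.map_span,
    ringKrullDim_eq_of_ringEquiv (DoubleQuot.quotQuotEquivQuotSup _ _)] at h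

variable [IsLocalRing R] [IsNoetherianRing R]

theorem ringKrullDim_quotient_le_quotient_sup_span_add_one {𝔞 : Ideal R} {r : R}
    (h𝔞 : 𝔞 ≠ ⊤) (hr : r ∈ IsLocalRing.maximalIdeal R) :
    ringKrullDim (R ⧸ 𝔞) ≤ ringKrullDim (R ⧸ 𝔞 ⊔ Ideal.span {r}) + 1 := by
  have : Nontrivial (R ⧸ 𝔞) := Ideal.Quotient.nontrivial_iff.mpr h𝔞
  have : IsLocalRing (R ⧸ 𝔞) :=
    .of_surjective' (Ideal.Quotient.mk 𝔞) Ideal.Quotient.mk_surjective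
  have hr' : Ideal.Quotient.mk 𝔞 r ∈ IsLocalRing.maximalIdeal (R ⧸ 𝔞) := by
    rw [IsLocalRing.mem_maximalIdeal, mem_nonunits_iff]
    rw [IsLocalRing.mem_maximalIdeal, mem_nonunits_iff] at hr
    have : IsLocalHom (Ideal.Quotient.mk 𝔞) :=
      .of_surjective _ Ideal.Quotient.mk_surjective
    exact fun h => hr (isUnit_of_map_unit _ _ h)
  have h := ringKrullDim_le_ringKrullDim_quotient_add_card {Ideal.Quotient.mk 𝔞 r}
    (by
      rw [Finset.coe_singleton, Set.singleton_subset_iff, SetLike.mem_coe,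
        IsLocalRing.ringJacobson_eq_maximalIdeal]
      exact hr')
  rwa [Finset.coe_singleton, ← Set.image_singleton, ← Ideal.map_span,
    ringKrullDim_eq_of_ringEquiv (DoubleQuot.quotQuotEquivQuotSup _ _),
    Finset.card_singleton, Nat.cast_one] at h

/-- In a Noetherian local ring, if `𝔞 + (r)` is prime and the dimension drops from `R ⧸ 𝔞` to
`R ⧸ 𝔞 + (r)`, then `𝔞` is prime. -/
theorem isPrime_of_isPrime_sup_span {𝔞 : Ideal R} {r : R} {n : ℕ}
    (hr : r ∈ IsLocalRing.maximalIdeal R) (hP : (𝔞 ⊔ Ideal.span {r}).IsPrime)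
    (hn : ringKrullDim (R ⧸ 𝔞 ⊔ Ideal.span {r}) = n)
    (hn' : ((n + 1 : ℕ) : WithBot ℕ∞) ≤ ringKrullDim (R ⧸ 𝔞)) : 𝔞.IsPrime := by
  obtain ⟨q, hq, h𝔞q, hdim⟩ := exists_isPrime_le_ringKrullDim_quotient hn'
  have hrq : r ∉ q := fun hrq => by
    have h1 : ringKrullDim (R ⧸ q) ≤ ringKrullDim (R ⧸ 𝔞 ⊔ Ideal.span {r}) :=
      ringKrullDim_le_of_surjective
        (Ideal.Quotient.factor (sup_le h𝔞q ((Ideal.span_singleton_le_iff_mem q).mpr hrq)))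
        (Ideal.Quotient.factor_surjective _)
    have h2 := hdim.trans (h1.trans hn.le)
    have h3 : n + 1 ≤ n := by exact_mod_cast h2
    omega
  -- An `s ∈ q` outside this prime would make `R ⧸ q + (r)` of dimension at most `n - 1`, hence `R ⧸
  -- q` of dimension at most `n`.
  have hqP : q ≤ 𝔞 ⊔ Ideal.span {r} := fun s hs => by
    by_contra hsP
    have h1 := ringKrullDim_quotient_sup_span_add_one_le hP hsP
    have h2 := hdim.trans (ringKrullDim_quotient_le_quotient_sup_span_add_one hq.ne_top hr)
    have h3 : ringKrullDim (R ⧸ q ⊔ Ideal.span {r}) ≤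
        ringKrullDim (R ⧸ (𝔞 ⊔ Ideal.span {r}) ⊔ Ideal.span {s}) :=
      ringKrullDim_le_of_surjective
        (Ideal.Quotient.factor (sup_le (sup_le_sup_right h𝔞q _)
          ((Ideal.span_singleton_le_iff_mem _).mpr (Ideal.mem_sup_left hs))))
        (Ideal.Quotient.factor_surjective _)
    have h4 : ((n + 1 : ℕ) : WithBot ℕ∞) ≤ n :=
      h2.trans ((add_le_add_left h3 1).trans (h1.trans hn.le))
    have h5 : n + 1 ≤ n := by exact_mod_cast h4
    omega
  -- Nakayama: an element of `q` is `u + tr` with `u ∈ 𝔞`, and `tr ∈ q` forces `t ∈ q`, so `q ⊆ 𝔞 +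
  -- 𝔪q`.
  have hle : q ≤ 𝔞 := by
    refine Submodule.le_of_le_smul_of_le_jacobson_bot (I := IsLocalRing.maximalIdeal R)
      (IsNoetherian.noetherian q) (IsLocalRing.jacobson_eq_maximalIdeal ⊥ bot_ne_top).ge ?_
    intro s hs
    obtain ⟨u, hu, v, hv, rfl⟩ := Submodule.mem_sup.mp (hqP hs)
    obtain ⟨t, rfl⟩ := Ideal.mem_span_singleton'.mp hv
    have : t * r ∈ q := (Submodule.add_mem_iff_right q (h𝔞q hu)).mp hs
    have ht := (hq.mem_or_mem this).resolve_right hrq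
    refine Submodule.add_mem_sup hu ?_
    rw [mul_comm]
    exact Submodule.smul_mem_smul hr ht
  rwa [le_antisymm h𝔞q hle]

/-- In a three-dimensional local ring whose maximal ideal is generated by `x`, `y`, `z`, the
ideals `0`, `(x)` and `(x, z)` are prime and `x`, `z`, `y` is a regular sequence. -/
theorem isPrime_of_regular_parameters (hdim : ringKrullDim R = 3) {x y z : R}
    (hm : IsLocalRing.maximalIdeal R = Ideal.span {x, y, z}) :
    (⊥ : Ideal R).IsPrime ∧ (Ideal.span {x} : Ideal R).IsPrime ∧
      (Ideal.span {x, z} : Ideal R).IsPrime ∧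
      x ≠ 0 ∧ z ∉ Ideal.span {x} ∧ y ∉ Ideal.span {x, z} := by
  have hx : x ∈ IsLocalRing.maximalIdeal R := hm ▸ Ideal.subset_span (by simp)
  have hy : y ∈ IsLocalRing.maximalIdeal R := hm ▸ Ideal.subset_span (by simp)
  have hz : z ∈ IsLocalRing.maximalIdeal R := hm ▸ Ideal.subset_span (by simp)
  have e1 : (⊥ : Ideal R) ⊔ Ideal.span {x} = Ideal.span {x} := bot_sup_eq _
  have e2 : (Ideal.span {x} : Ideal R) ⊔ Ideal.span {z} = Ideal.span {x, z} := by
    rw [← Ideal.span_union]; rfl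
  have e3 : (Ideal.span {x, z} : Ideal R) ⊔ Ideal.span {y} = IsLocalRing.maximalIdeal R := by
    rw [← Ideal.span_union, hm]; congr 1; ext; simp; tauto
  have le_m {s : Set R} (hs : s ⊆ IsLocalRing.maximalIdeal R) : Ideal.span s ≠ ⊤ :=
    ne_top_of_le_ne_top (IsLocalRing.maximalIdeal.isMaximal R).ne_top (Ideal.span_le.mpr hs)
  have d0 : ringKrullDim (R ⧸ (⊥ : Ideal R)) = 3 := by
    rw [← hdim]; exact ringKrullDim_eq_of_ringEquiv (RingEquiv.quotientBot R)
  have i1 := ringKrullDim_quotient_le_quotient_sup_span_add_one (𝔞 := (⊥ : Ideal R))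
    bot_ne_top hx
  have i2 := ringKrullDim_quotient_le_quotient_sup_span_add_one
    (le_m (Set.singleton_subset_iff.mpr hx)) hz
  have i3 := ringKrullDim_quotient_le_quotient_sup_span_add_one
    (le_m (Set.pair_subset hx hz)) hy
  have d3 : ringKrullDim (R ⧸ IsLocalRing.maximalIdeal R) = 0 :=
    ringKrullDim_eq_zero_of_field (IsLocalRing.ResidueField R)
  rw [e1, d0] at i1
  rw [e2] at i2
  rw [e3, d3] at i3
  -- The dimension falls from 3 to 0 in three steps of at most 1, so each step is exactly 1.
  obtain ⟨d1, d2⟩ : ringKrullDim (R ⧸ (Ideal.span {x} : Ideal R)) = (2 : ℕ) ∧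
      ringKrullDim (R ⧸ (Ideal.span {x, z} : Ideal R)) = (1 : ℕ) := by
    generalize ringKrullDim (R ⧸ (Ideal.span {x} : Ideal R)) = u at *
    generalize ringKrullDim (R ⧸ (Ideal.span {x, z} : Ideal R)) = v at *
    cases u using WithBot.recBotCoe with
    | bot => simp at i1
    | coe u =>
      cases v using WithBot.recBotCoe with
      | bot => simp at i2
      | coe v =>
        cases v using ENat.recTopCoe with
        | top => exact absurd i3 (by decide)
        | coe v =>
          cases u using ENat.recTopCoe with
          | top => exact absurd i2 (by rintro h; norm_cast at h)
          | coe u =>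
            have i1' : 3 ≤ u + 1 := ENat.natCast_le_natCast.mp (WithBot.coe_le_coe.mp i1)
            have i2' : u ≤ v + 1 := by exact_mod_cast i2
            have i3' : v ≤ 0 + 1 := by exact_mod_cast i3
            constructor
            · have : u = 2 := by omega
              rw [this]; rfl
            · have : v = 1 := by omega
              rw [this]; rfl
  have p2 : (Ideal.span {x, z} : Ideal R).IsPrime :=
    isPrime_of_isPrime_sup_span hy (e3 ▸ (IsLocalRing.maximalIdeal.isMaximal R).isPrime)
      (n := 0) (by rw [e3, d3]; rfl) d2.ge
  have p1 : (Ideal.span {x} : Ideal R).IsPrime :=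
    isPrime_of_isPrime_sup_span hz (e2 ▸ p2) (n := 1) (by rw [e2, d2]) d1.ge
  have p0 : (⊥ : Ideal R).IsPrime :=
    isPrime_of_isPrime_sup_span hx (by rwa [e1]) (n := 2) (by rw [e1, d1]) (by rw [d0]; rfl)
  have ne {m n : ℕ} (h : m ≠ n) : (m : WithBot ℕ∞) ≠ n := by exact_mod_cast h
  refine ⟨p0, p1, p2, ?_, ?_, ?_⟩
  · rintro rfl
    rw [Ideal.span_singleton_eq_bot.mpr rfl, d0] at d1
    exact ne (m := 3) (n := 2) (by norm_num) d1
  · intro h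
    rw [sup_eq_left.mpr ((Ideal.span_singleton_le_iff_mem _).mpr h)] at e2
    rw [← e2, d1] at d2
    exact ne (m := 2) (n := 1) (by norm_num) d2
  · intro h
    rw [sup_eq_left.mpr ((Ideal.span_singleton_le_iff_mem _).mpr h)] at e3
    rw [e3, d3] at d2
    exact ne (m := 0) (n := 1) (by norm_num) d2

end RegularParameters

/-! ### Regular sequences are quasi-regular. -/

section QuasiRegular

variable {R : Type*} [CommRing R] {σ : Type*}

/-- The forms of degree `e` in the variables from `T`, with coefficients in the ideal `K`. -/
def formsOn (K : Ideal R) (T : Set σ) (e : ℕ) : Submodule R (MvPolynomial σ R) where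
  carrier := {F | ∀ d, F.coeff d ∈ K ∧ (F.coeff d ≠ 0 → d.degree = e ∧ ↑d.support ⊆ T)}
  zero_mem' d := by simp
  add_mem' {F G} hF hG d := by
    refine ⟨by simpa using K.add_mem (hF d).1 (hG d).1, fun h => ?_⟩
    by_cases h0 : F.coeff d = 0
    · refine (hG d).2 fun h1 => h ?_
      rw [MvPolynomial.coeff_add, h0, h1, add_zero]
    · exact (hF d).2 h0
  smul_mem' r F hF d := by
    rw [MvPolynomial.coeff_smul, smul_eq_mul]
    exact ⟨K.mul_mem_left r (hF d).1, fun h => (hF d).2 (right_ne_zero_of_mul h)⟩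

theorem formsOn_mono {K L : Ideal R} {T U : Set σ} (hK : K ≤ L) (hT : T ⊆ U) (e : ℕ) :
    formsOn K T e ≤ formsOn L U e :=
  fun _ hF d => ⟨hK (hF d).1, fun h => ⟨((hF d).2 h).1, ((hF d).2 h).2.trans hT⟩⟩

theorem mul_mem_formsOn {K : Ideal R} {T : Set σ} {e : ℕ} {i : σ} (hi : i ∈ T)
    {F : MvPolynomial σ R} (hF : F ∈ formsOn K T e) :
    F * MvPolynomial.X i ∈ formsOn K T (e + 1) := by
  classical
  intro d
  rw [MvPolynomial.coeff_mul_X']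
  split_ifs with h
  · refine ⟨(hF _).1, fun h0 => ?_⟩
    obtain ⟨h1, h2⟩ := (hF _).2 h0
    have hle : Finsupp.single i 1 ≤ d := by
      rw [Finsupp.single_le_iff]
      exact Nat.one_le_iff_ne_zero.mpr (Finsupp.mem_support_iff.mp h)
    have hd : d = d - Finsupp.single i 1 + Finsupp.single i 1 := (tsub_add_cancel_of_le hle).symm
    refine ⟨by rw [hd, map_add, h1, Finsupp.degree_single], fun j hj => ?_⟩
    by_cases hji : j = i
    · exact hji ▸ hi
    · refine h2 ?_
      simp only [Finset.mem_coe, Finsupp.mem_support_iff, Finsupp.tsub_apply] at hj ⊢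
      rwa [Finsupp.single_eq_of_ne hji, tsub_zero]
  · simp

/-- The dictionary between products `K * Jᵉ` and forms, used to lift ideal members to polynomials.
-/
theorem map_aeval_formsOn (s : σ → R) (K : Ideal R) (T : Set σ) (e : ℕ) :
    (formsOn K T e).map (MvPolynomial.aeval s).toLinearMap = K * Ideal.span (s '' T) ^ e := by
  apply le_antisymm
  · refine Submodule.map_le_iff_le_comap.mpr fun F hF => ?_
    rw [Submodule.mem_comap, AlgHom.toLinearMap_apply, MvPolynomial.aeval_def, MvPolynomial.eval₂_eq]
    refine Ideal.sum_mem _ fun d hd => ?_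
    have hF : F ∈ formsOn K T e := hF
    obtain ⟨hK, h⟩ := hF d
    obtain ⟨rfl, hT⟩ := h (MvPolynomial.mem_support_iff.mp hd)
    refine Ideal.mul_mem_mul hK ?_
    rw [Finsupp.degree_apply, ← Finset.prod_pow_eq_pow_sum]
    exact Ideal.prod_mem_prod fun i hi =>
      Ideal.pow_mem_pow (Ideal.subset_span (Set.mem_image_of_mem s (hT hi))) _
  · induction e with
    | zero =>
      intro r hr
      rw [pow_zero, mul_one] at hr
      refine ⟨MvPolynomial.C r, fun d => ?_, by simp⟩
      classical
      rw [MvPolynomial.coeff_C]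
      split_ifs with h
      · subst h; simpa using hr
      · simp
    | succ e ih =>
      rw [pow_succ, ← mul_assoc]
      refine Submodule.mul_le.mpr fun r hr t ht => ?_
      obtain ⟨F, hF, rfl⟩ := ih hr
      refine Submodule.span_induction (p := fun t _ => (MvPolynomial.aeval s).toLinearMap F * t ∈
        (formsOn K T (e + 1)).map (MvPolynomial.aeval s).toLinearMap) ?_ ?_ ?_ ?_ ht
      · rintro _ ⟨i, hi, rfl⟩
        exact ⟨_, mul_mem_formsOn hi hF, by simp⟩
      · simp
      · intro u v _ _ hu hv
        rw [mul_add]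
        exact add_mem hu hv
      · intro c u _ hu
        rw [smul_eq_mul, mul_left_comm]
        exact Submodule.smul_mem _ c hu

/-- The family `s` is quasi-regular on `T`: the coefficients of a form in the variables from `T`
that vanishes at `s` lie in the ideal generated by `s '' T`. -/
def IsQuasiRegularOn (s : σ → R) (T : Set σ) : Prop :=
  ∀ e, ∀ F ∈ formsOn ⊤ T e, MvPolynomial.aeval s F = 0 → F ∈ formsOn (Ideal.span (s '' T)) T e

theorem exists_mem_formsOn {s : σ → R} {K : Ideal R} {T : Set σ} {e : ℕ} {r : R}
    (hr : r ∈ K * Ideal.span (s '' T) ^ e) :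
    ∃ F ∈ formsOn K T e, MvPolynomial.aeval s F = r := by
  rw [← map_aeval_formsOn] at hr
  exact hr

/-- The leading form criterion for quasi-regular families. -/
theorem IsQuasiRegularOn.mem_formsOn {s : σ → R} {T : Set σ} (h : IsQuasiRegularOn s T) {e : ℕ}
    {F : MvPolynomial σ R} (hF : F ∈ formsOn ⊤ T e)
    (h' : MvPolynomial.aeval s F ∈ Ideal.span (s '' T) ^ (e + 1)) :
    F ∈ formsOn (Ideal.span (s '' T)) T e := by
  rw [pow_succ'] at h'
  obtain ⟨G, hG, hGF⟩ := exists_mem_formsOn h'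
  have := h e (F - G) (sub_mem hF (formsOn_mono le_top subset_rfl e hG)) (by rw [map_sub, hGF, sub_self])
  simpa using add_mem this hG

theorem isQuasiRegularOn_empty (s : σ → R) : IsQuasiRegularOn s ∅ := by
  intro e F hF h0
  have hFC : F = MvPolynomial.C (F.coeff 0) := by
    classical
    ext d
    rw [MvPolynomial.coeff_C]
    split_ifs with h
    · rw [h]
    · by_contra hd
      have := ((hF d).2 hd).2
      rw [Set.subset_empty_iff, Finset.coe_eq_empty, Finsupp.support_eq_empty] at this
      exact h this.symm
  rw [hFC] at h0 ⊢
  rw [MvPolynomial.aeval_C, Algebra.algebraMap_self, RingHom.id_apply] at h0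
  rw [h0, MvPolynomial.C_0]
  exact zero_mem _

/-- An element that is a nonzerodivisor modulo the ideal of a quasi-regular family is a
nonzerodivisor modulo its powers. -/
theorem IsQuasiRegularOn.mem_pow_of_mul_mem {s : σ → R} {T : Set σ} (h : IsQuasiRegularOn s T)
    {t : R} (ht : ∀ c, t * c ∈ Ideal.span (s '' T) → c ∈ Ideal.span (s '' T)) (e : ℕ) {c : R}
    (hc : t * c ∈ Ideal.span (s '' T) ^ e) : c ∈ Ideal.span (s '' T) ^ e := by
  induction e generalizing c with
  | zero => simp
  | succ e ih =>
    have hce := ih (Ideal.pow_le_pow_right e.le_succ hc)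
    rw [← one_mul (_ ^ e), Ideal.one_eq_top] at hce
    obtain ⟨F, hF, rfl⟩ := exists_mem_formsOn hce
    have h1 : t • F ∈ formsOn (Ideal.span (s '' T)) T e :=
      h.mem_formsOn (Submodule.smul_mem _ t hF) (by simpa using hc)
    have h2 : F ∈ formsOn (Ideal.span (s '' T)) T e := fun d => by
      have h3 := (h1 d).1
      rw [MvPolynomial.coeff_smul] at h3
      exact ⟨ht _ h3, (hF d).2⟩
    rw [pow_succ', ← map_aeval_formsOn]
    exact ⟨F, h2, rfl⟩

theorem exists_formsOn_insert_succ {T : Set σ} {i : σ} {e : ℕ} {F : MvPolynomial σ R}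
    (hF : F ∈ formsOn ⊤ (insert i T) (e + 1)) :
    ∃ G ∈ formsOn (⊤ : Ideal R) (insert i T) e, ∃ H ∈ formsOn (⊤ : Ideal R) T (e + 1),
      F = G * MvPolynomial.X i + H := by
  refine ⟨F.divMonomial (Finsupp.single i 1), fun d => ⟨trivial, fun hd => ?_⟩,
    F.modMonomial (Finsupp.single i 1), fun d => ⟨trivial, fun hd => ?_⟩, ?_⟩
  · rw [MvPolynomial.coeff_divMonomial] at hd
    obtain ⟨h1, h2⟩ := (hF _).2 hd
    rw [map_add, Finsupp.degree_single] at h1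
    refine ⟨by omega, fun j hj => h2 ?_⟩
    simp only [Finset.mem_coe, Finsupp.mem_support_iff, Finsupp.add_apply] at hj ⊢
    omega
  · by_cases hle : Finsupp.single i 1 ≤ d
    · exact absurd (MvPolynomial.coeff_modMonomial_of_le F hle) hd
    rw [MvPolynomial.coeff_modMonomial_of_not_le F hle] at hd
    obtain ⟨h1, h2⟩ := (hF _).2 hd
    refine ⟨h1, fun j hj => (h2 hj).resolve_left ?_⟩
    rintro rfl
    refine hle ?_
    rw [Finsupp.single_le_iff]
    exact Nat.one_le_iff_ne_zero.mpr (Finsupp.mem_support_iff.mp hj)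
  · conv_lhs => rw [← MvPolynomial.divMonomial_add_modMonomial F (Finsupp.single i 1)]
    rw [mul_comm]
    rfl

/-- Split `F = G Xᵢ + H` with `H` free of `Xᵢ`. From `F(s) = 0`, cancelling `sᵢ` modulo a power of
the old ideal puts `G(s)` in that power; induction on the degree handles `G`, and the old
quasi-regularity handles `H`. -/
theorem IsQuasiRegularOn.insert_of_mul_mem {s : σ → R} {T : Set σ} (h : IsQuasiRegularOn s T) {i : σ}
    (hi : ∀ c, s i * c ∈ Ideal.span (s '' T) → c ∈ Ideal.span (s '' T)) :
    IsQuasiRegularOn s (insert i T) := by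
  have hle : Ideal.span (s '' T) ≤ Ideal.span (s '' insert i T) :=
    Ideal.span_mono (Set.image_mono (Set.subset_insert i T))
  have hsi : s i ∈ Ideal.span (s '' insert i T) :=
    Ideal.subset_span ⟨i, Set.mem_insert i T, rfl⟩
  intro e
  induction e with
  | zero =>
    intro F hF h0
    have hF' : F ∈ formsOn ⊤ ∅ 0 := fun d => ⟨trivial, fun hd => by
      have h1 := ((hF d).2 hd).1
      rw [Finsupp.degree_eq_zero_iff] at h1
      simp [h1]⟩
    have := isQuasiRegularOn_empty s 0 F hF' h0
    exact formsOn_mono (by simp) (Set.empty_subset _) 0 this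
  | succ e ih =>
    intro F hF h0
    obtain ⟨G, hG, H, hH, rfl⟩ := exists_formsOn_insert_succ hF
    rw [map_add, map_mul, MvPolynomial.aeval_X] at h0
    have hHmem : MvPolynomial.aeval s H ∈ Ideal.span (s '' T) ^ (e + 1) := by
      rw [← one_mul (_ ^ (e + 1)), Ideal.one_eq_top, ← map_aeval_formsOn]
      exact ⟨H, hH, rfl⟩
    have hGmem : MvPolynomial.aeval s G ∈ Ideal.span (s '' T) ^ (e + 1) := by
      refine h.mem_pow_of_mul_mem hi _ ?_
      rw [mul_comm, eq_neg_of_add_eq_zero_left h0]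
      exact neg_mem hHmem
    have hGK : G ∈ formsOn (Ideal.span (s '' insert i T)) (insert i T) e := by
      have h1 := Ideal.pow_right_mono hle (e + 1) hGmem
      rw [pow_succ'] at h1
      obtain ⟨G', hG', hGG'⟩ := exists_mem_formsOn h1
      have := ih (G - G') (sub_mem hG (formsOn_mono le_top subset_rfl e hG')) (by rw [map_sub, hGG', sub_self])
      simpa using add_mem this hG'
    refine add_mem (mul_mem_formsOn (Set.mem_insert i T) hGK) ?_
    -- Writing `G(s) = H'(s)` with `H'` a form in the old variables makes `H + sᵢ H'` vanish at `s`,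
    -- while `sᵢ H'` has coefficients in the new ideal.
    rw [← one_mul (_ ^ (e + 1)), Ideal.one_eq_top] at hGmem
    obtain ⟨H', hH', hGH'⟩ := exists_mem_formsOn hGmem
    have h2 := h (e + 1) (H + s i • H') (add_mem hH (Submodule.smul_mem _ _ hH')) (by
      rw [map_add, map_smul, hGH', smul_eq_mul, ← h0]; ring)
    have h3 : s i • H' ∈ formsOn (Ideal.span (s '' insert i T)) (insert i T)
        (e + 1) := fun d => by
      refine ⟨?_, fun hd => ⟨((hH' d).2 ?_).1, ((hH' d).2 ?_).2.trans (Set.subset_insert i T)⟩⟩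
      · rw [MvPolynomial.coeff_smul]
        exact Ideal.mul_mem_right _ _ hsi
      all_goals
        rw [MvPolynomial.coeff_smul] at hd
        exact right_ne_zero_of_mul hd
    have := sub_mem (formsOn_mono hle (Set.subset_insert i T) (e + 1) h2) h3
    simpa using this

end QuasiRegular

/-- Regular parameters `x`, `y`, `z` of a three-dimensional regular local ring are quasi-regular:
the coefficients of a form `F` of degree `e` with `F(x, y, z) ∈ 𝔪 ^ (e + 1)` lie in `𝔪`. -/
theorem coeff_mem_maximalIdeal_of_aeval_mem_pow {R : Type*} [CommRing R] [IsLocalRing R]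
    [IsNoetherianRing R] (hdim : ringKrullDim R = 3) {x y z : R}
    (hm : IsLocalRing.maximalIdeal R = Ideal.span {x, y, z})
    {F : MvPolynomial (Fin 3) R} {e : ℕ} (hF : F.IsHomogeneous e)
    (h : MvPolynomial.aeval ![x, y, z] F ∈ IsLocalRing.maximalIdeal R ^ (e + 1))
    (d : Fin 3 →₀ ℕ) : F.coeff d ∈ IsLocalRing.maximalIdeal R := by
  obtain ⟨p0, p1, p2, hx, hz, hy⟩ := isPrime_of_regular_parameters hdim hm
  have nzd {P : Ideal R} (hP : P.IsPrime) {t : R} (ht : t ∉ P) (c : R) (hc : t * c ∈ P) : c ∈ P :=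
    (hP.mem_or_mem hc).resolve_left ht
  have e0 : Ideal.span (![x, y, z] '' (∅ : Set (Fin 3))) = ⊥ := by simp
  -- The variables enter in the order `x`, `z`, `y`, matching the primes `(x)` and `(x, z)`.
  have q0 : IsQuasiRegularOn ![x, y, z] (insert (0 : Fin 3) ∅) :=
    (isQuasiRegularOn_empty _).insert_of_mul_mem (e0 ▸ nzd p0 (by simpa using hx))
  have e1 : Ideal.span (![x, y, z] '' (insert (0 : Fin 3) ∅)) = Ideal.span {x} := by simp
  have q1 : IsQuasiRegularOn ![x, y, z] (insert (2 : Fin 3) (insert 0 ∅)) :=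
    q0.insert_of_mul_mem (e1 ▸ nzd p1 (by simpa using hz))
  have e2 : Ideal.span (![x, y, z] '' (insert (2 : Fin 3) (insert 0 ∅))) = Ideal.span {x, z} := by
    simp [Set.image_insert_eq, Set.pair_comm]
  have q2 : IsQuasiRegularOn ![x, y, z] (insert (1 : Fin 3) (insert 2 (insert 0 ∅))) :=
    q1.insert_of_mul_mem (e2 ▸ nzd p2 (by simpa using hy))
  have huniv : (insert (1 : Fin 3) (insert 2 (insert 0 ∅)) : Set (Fin 3)) = Set.univ := by
    ext i; fin_cases i <;> simp
  have e3 : Ideal.span (![x, y, z] '' (Set.univ : Set (Fin 3))) = IsLocalRing.maximalIdeal R := by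
    rw [hm, Set.image_univ]
    congr 1
    ext r
    simp [@eq_comm R r]
    tauto
  rw [huniv] at q2
  have := q2.mem_formsOn (e := e) (F := F) (fun d => ⟨trivial, fun hd =>
    ⟨by have := hF hd; rwa [Finsupp.degree_eq_weight_one], Set.subset_univ _⟩⟩)
    (by rwa [e3])
  rw [e3] at this
  exact (this d).1

/-! ### Independence of the leading forms of the minors. -/

section LeadingForms

open MvPolynomial

/-- The leading forms `XZ - Y²`, `-YZ`, `-Z²` of the minors satisfy no homogeneous relation. -/
theorem eq_zero_of_aeval_leadingForms_eq_zero {k : Type*} [Field k]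
    {P : MvPolynomial (Fin 3) k} {N : ℕ} (hP : P.IsHomogeneous N)
    (h : aeval ![X 0 * X 2 - X 1 ^ 2, -(X 1 * X 2), -X 2 ^ 2] P = (0 : MvPolynomial (Fin 3) k)) :
    P = 0 := by
  let A := MvPolynomial (Fin 3) k
  let L := FractionRing A
  let ι : A →ₐ[k] L := IsScalarTower.toAlgHom k A L
  have hι : Function.Injective ι := IsFractionRing.injective A L
  have hZ : ι (X 2) ≠ 0 := by
    rw [Ne, map_eq_zero_iff _ hι]
    exact X_ne_zero 2
  -- Substituting `(Y² - XZ)/Z` for `X` turns the three forms into `-Z` times `X`, `Y`, `Z`, so by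
  -- homogeneity the relation becomes `(-Z)ᴺ P = 0`.
  have h1 : aeval (fun i => (-ι (X 2)) • ι (X i)) P = 0 := by
    have h2 := congrArg (aeval ![(ι (X 1) ^ 2 - ι (X 0) * ι (X 2)) / ι (X 2), ι (X 1), ι (X 2)]) h
    rw [map_zero, comp_aeval_apply] at h2
    rw [← h2]
    congr 2
    funext i
    fin_cases i
    · simp [div_mul_cancel₀ _ hZ]
      ring
    · simp; ring
    · simp; ring
  have h2 : aeval (fun i => (-ι (X 2)) • ι (X i)) P = (-ι (X 2)) ^ N * ι P := by
    conv_rhs => rw [← aeval_X_left_apply P, comp_aeval_apply]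
    rw [aeval_def, aeval_def, eval₂_eq, eval₂_eq, Finset.mul_sum]
    refine Finset.sum_congr rfl fun d hd => ?_
    have hd' : d.degree = N := by
      rw [Finsupp.degree_eq_weight_one]
      exact hP (mem_support_iff.mp hd)
    rw [mul_left_comm, ← hd', Finsupp.degree_apply, ← Finset.prod_pow_eq_pow_sum,
      ← Finset.prod_mul_distrib]
    simp only [smul_eq_mul, mul_pow]
  rw [h2, mul_eq_zero, or_iff_right (pow_ne_zero _ (neg_ne_zero.mpr hZ)),
    map_eq_zero_iff _ hι] at h1
  exact h1

end LeadingForms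

/-! ### The curve ideal, the element `d` and the ideals `Sₙ`. -/

section Curve

variable {R : Type*} [CommRing R]

/-- The ideal generated by the maximal minors of `(x y z; y z x²)`. -/
def curveIdeal (x y z : R) : Ideal R :=
  Ideal.span (Set.range ![x * z - y ^ 2, x ^ 3 - y * z, y * x ^ 2 - z ^ 2])

/-- The element of the second symbolic power of `curveIdeal x y z` not in its square. -/
def curveElt (x y z : R) : R := x ^ 5 - 3 * x ^ 2 * y * z + z ^ 3 + x * y ^ 3

theorem maximalMinorsIdeal_eq_curveIdeal (x y z : R) :
    maximalMinorsIdeal !![x, y, z; y, z, x ^ 2] = curveIdeal x y z := by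
  have hval : ∀ i j : Fin 3, i < j → ((!![x, y, z; y, z, x ^ 2] : Matrix (Fin 2) (Fin 3) R) 0 i *
      (!![x, y, z; y, z, x ^ 2] : Matrix (Fin 2) (Fin 3) R) 1 j -
      (!![x, y, z; y, z, x ^ 2] : Matrix (Fin 2) (Fin 3) R) 0 j *
      (!![x, y, z; y, z, x ^ 2] : Matrix (Fin 2) (Fin 3) R) 1 i) ∈
      Set.range ![x * z - y ^ 2, x ^ 3 - y * z, y * x ^ 2 - z ^ 2] := by
    intro i j hij
    fin_cases i <;> fin_cases j <;> first | exact absurd hij (by decide) | skip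
    · exact ⟨0, by simp; ring⟩
    · exact ⟨1, by simp; ring⟩
    · exact ⟨2, by simp; ring⟩
  unfold maximalMinorsIdeal curveIdeal
  congr 1
  apply Set.Subset.antisymm
  · rintro _ ⟨e, rfl⟩
    dsimp only
    rw [Matrix.det_fin_two]
    exact hval (e 0) (e 1) (e.strictMono (by decide))
  · have key : ∀ i j : Fin 3, i < j → ∃ e : Fin 2 ↪o Fin 3, e 0 = i ∧ e 1 = j := fun i j hij =>
      ⟨OrderEmbedding.ofStrictMono ![i, j] (by
        intro a b hab
        fin_cases a <;> fin_cases b <;> first | exact absurd hab (by decide) | exact hij),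
        rfl, rfl⟩
    rintro _ ⟨i, rfl⟩
    fin_cases i
    · obtain ⟨e, h0, h1⟩ := key 0 1 (by decide)
      exact ⟨e, by simp [Matrix.det_fin_two, h0, h1]; ring⟩
    · obtain ⟨e, h0, h1⟩ := key 0 2 (by decide)
      exact ⟨e, by simp [Matrix.det_fin_two, h0, h1]; ring⟩
    · obtain ⟨e, h0, h1⟩ := key 1 2 (by decide)
      exact ⟨e, by simp [Matrix.det_fin_two, h0, h1]; ring⟩

/-- The ideals `∑ₖ dᵏ Iⁿ⁻²ᵏ` for `I = curveIdeal x y z` and `d = curveElt x y z`. -/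
def curveSymbolic (x y z : R) : ℕ → Ideal R
  | 0 => ⊤
  | 1 => curveIdeal x y z
  | n + 2 => curveIdeal x y z ^ (n + 2) ⊔ Ideal.span {curveElt x y z} * curveSymbolic x y z n

variable {x y z : R}

theorem minor_zero_mem : x * z - y ^ 2 ∈ curveIdeal x y z := Ideal.subset_span ⟨0, rfl⟩

theorem minor_one_mem : x ^ 3 - y * z ∈ curveIdeal x y z := Ideal.subset_span ⟨1, rfl⟩

theorem minor_two_mem : y * x ^ 2 - z ^ 2 ∈ curveIdeal x y z := Ideal.subset_span ⟨2, rfl⟩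

theorem exists_of_mem_curveIdeal {r : R} (h : r ∈ curveIdeal x y z) : ∃ r₀ r₁ r₂ : R,
    r = r₀ * (x * z - y ^ 2) + r₁ * (x ^ 3 - y * z) + r₂ * (y * x ^ 2 - z ^ 2) := by
  obtain ⟨c, rfl⟩ := Ideal.mem_span_range_iff_exists_fun.mp h
  exact ⟨c 0, c 1, c 2, by simp [Fin.sum_univ_three]⟩

theorem curveIdeal_le {K : Ideal R} (h0 : x * z - y ^ 2 ∈ K) (h1 : x ^ 3 - y * z ∈ K)
    (h2 : y * x ^ 2 - z ^ 2 ∈ K) : curveIdeal x y z ≤ K := by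
  refine Ideal.span_le.mpr ?_
  rintro _ ⟨i, rfl⟩
  fin_cases i
  exacts [h0, h1, h2]

/-- By `xd = b² - ac`, `yd = bc + xa²` and `zd = c² + xab`. -/
theorem mul_curveElt_mem {r : R} (hr : r ∈ Ideal.span {x, y, z}) :
    r * curveElt x y z ∈ curveIdeal x y z ^ 2 := by
  have mm {u v : R} (hu : u ∈ curveIdeal x y z) (hv : v ∈ curveIdeal x y z) (t : R) :
      t * (u * v) ∈ curveIdeal x y z ^ 2 :=
    Ideal.mul_mem_left _ _ (pow_two (curveIdeal x y z) ▸ Ideal.mul_mem_mul hu hv)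
  have hle : Ideal.span {x, y, z} ≤
      Submodule.comap (LinearMap.mulRight R (curveElt x y z)) (curveIdeal x y z ^ 2) := by
    refine Ideal.span_le.mpr ?_
    rintro r (hr | hr | hr) <;> rw [hr, SetLike.mem_coe, Submodule.mem_comap,
      LinearMap.mulRight_apply]
    · have := sub_mem (mm (minor_one_mem (x := x) (y := y) (z := z)) minor_one_mem 1)
        (mm (minor_zero_mem (x := x) (y := y) (z := z)) minor_two_mem 1)
      convert this using 1
      rw [curveElt]; ring
    · have := add_mem (mm (minor_one_mem (x := x) (y := y) (z := z)) minor_two_mem 1)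
        (mm (minor_zero_mem (x := x) (y := y) (z := z)) minor_zero_mem x)
      convert this using 1
      rw [curveElt]; ring
    · have := add_mem (mm (minor_two_mem (x := x) (y := y) (z := z)) minor_two_mem 1)
        (mm (minor_zero_mem (x := x) (y := y) (z := z)) minor_one_mem x)
      convert this using 1
      rw [curveElt]; ring
  exact hle hr

theorem curveElt_mul_mem_curveIdeal_pow {n : ℕ} {r : R}
    (hr : r ∈ Ideal.span {x, y, z} * curveIdeal x y z ^ n) :
    curveElt x y z * r ∈ curveIdeal x y z ^ (n + 2) := by
  have hle : Ideal.span {x, y, z} * curveIdeal x y z ^ n ≤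
      Submodule.comap (LinearMap.mulLeft R (curveElt x y z)) (curveIdeal x y z ^ (n + 2)) := by
    refine Ideal.mul_le.mpr fun u hu v hv => ?_
    rw [Submodule.mem_comap, LinearMap.mulLeft_apply, ← mul_assoc, mul_comm _ u, add_comm n 2,
      pow_add]
    exact Ideal.mul_mem_mul (mul_curveElt_mem hu) hv
  exact hle hr

theorem pow_le_curveSymbolic (n : ℕ) : curveIdeal x y z ^ n ≤ curveSymbolic x y z n := by
  match n with
  | 0 => exact le_top
  | 1 => exact (pow_one _).le
  | n + 2 => exact le_sup_left

theorem curveElt_mul_mem {n : ℕ} {r : R} (h : r ∈ curveSymbolic x y z n) :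
    curveElt x y z * r ∈ curveSymbolic x y z (n + 2) :=
  Ideal.mem_sup_right (Ideal.mul_mem_mul (Ideal.mem_span_singleton_self _) h)

theorem exists_of_mem_curveSymbolic {n : ℕ} {r : R} (h : r ∈ curveSymbolic x y z (n + 2)) :
    ∃ f ∈ curveIdeal x y z ^ (n + 2), ∃ s ∈ curveSymbolic x y z n, r = f + curveElt x y z * s := by
  obtain ⟨f, hf, g, hg, rfl⟩ := Submodule.mem_sup.mp h
  obtain ⟨s, hs, rfl⟩ := Ideal.mem_span_singleton_mul.mp hg
  exact ⟨f, hf, s, hs, rfl⟩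

theorem curveIdeal_mul_curveSymbolic_le (n : ℕ) :
    curveIdeal x y z * curveSymbolic x y z n ≤ curveSymbolic x y z (n + 1) := by
  induction n using Nat.twoStepInduction with
  | zero =>
    change curveIdeal x y z * ⊤ ≤ curveIdeal x y z
    exact (Ideal.mul_top _).le
  | one =>
    change curveIdeal x y z * curveIdeal x y z ≤ _
    rw [← pow_two]
    exact pow_le_curveSymbolic 2
  | more n ih _ =>
    change curveIdeal x y z * (_ ⊔ _) ≤ _ ⊔ _
    rw [Ideal.mul_sup, ← pow_succ', mul_left_comm]
    exact sup_le_sup_left (Ideal.mul_mono_right ih) _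

theorem exists_isHomogeneous_of_mem_curveIdeal_pow {N : ℕ} {r : R}
    (hr : r ∈ curveIdeal x y z ^ N) : ∃ P : MvPolynomial (Fin 3) R, P.IsHomogeneous N ∧
      MvPolynomial.aeval ![x * z - y ^ 2, x ^ 3 - y * z, y * x ^ 2 - z ^ 2] P = r :=
  (Ideal.mem_span_pow_iff_exists_isHomogeneous _ _).mp hr

theorem aeval_mem_mul_curveIdeal_pow {K : Ideal R} {N : ℕ} {P : MvPolynomial (Fin 3) R}
    (hP : P.IsHomogeneous N) (h : ∀ i, P.coeff i ∈ K) :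
    MvPolynomial.aeval ![x * z - y ^ 2, x ^ 3 - y * z, y * x ^ 2 - z ^ 2] P ∈
      K * curveIdeal x y z ^ N := by
  have hP' : P ∈ formsOn K Set.univ N := fun d => ⟨h d, fun hd =>
    ⟨by rw [Finsupp.degree_eq_weight_one]; exact hP hd, Set.subset_univ _⟩⟩
  rw [curveIdeal, ← Set.image_univ, ← map_aeval_formsOn]
  exact ⟨P, hP', rfl⟩

/-! ### Orders of elements with respect to the maximal ideal. -/

section Order

variable [IsLocalRing R]

theorem curveIdeal_le_pow_two (hm : IsLocalRing.maximalIdeal R = Ideal.span {x, y, z}) :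
    curveIdeal x y z ≤ IsLocalRing.maximalIdeal R ^ 2 := by
  have hx : x ∈ IsLocalRing.maximalIdeal R := hm ▸ Ideal.subset_span (by simp)
  have hy : y ∈ IsLocalRing.maximalIdeal R := hm ▸ Ideal.subset_span (by simp)
  have hz : z ∈ IsLocalRing.maximalIdeal R := hm ▸ Ideal.subset_span (by simp)
  have mm {u v : R} (hu : u ∈ IsLocalRing.maximalIdeal R) (hv : v ∈ IsLocalRing.maximalIdeal R)
      (t : R) : t * (u * v) ∈ IsLocalRing.maximalIdeal R ^ 2 :=
    Ideal.mul_mem_left _ _ (pow_two (IsLocalRing.maximalIdeal R) ▸ Ideal.mul_mem_mul hu hv)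
  apply curveIdeal_le
  · convert sub_mem (mm hx hz 1) (mm hy hy 1) using 1; ring
  · convert sub_mem (mm hx hx x) (mm hy hz 1) using 1; ring
  · convert sub_mem (mm hx hx y) (mm hz hz 1) using 1; ring

theorem curveElt_mem_pow_three (hm : IsLocalRing.maximalIdeal R = Ideal.span {x, y, z}) :
    curveElt x y z ∈ IsLocalRing.maximalIdeal R ^ 3 := by
  have hx : x ∈ IsLocalRing.maximalIdeal R := hm ▸ Ideal.subset_span (by simp)
  have hy : y ∈ IsLocalRing.maximalIdeal R := hm ▸ Ideal.subset_span (by simp)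
  have hz : z ∈ IsLocalRing.maximalIdeal R := hm ▸ Ideal.subset_span (by simp)
  have mm {u v w : R} (hu : u ∈ IsLocalRing.maximalIdeal R) (hv : v ∈ IsLocalRing.maximalIdeal R)
      (hw : w ∈ IsLocalRing.maximalIdeal R) (t : R) :
      t * (u * v * w) ∈ IsLocalRing.maximalIdeal R ^ 3 := by
    rw [pow_three']
    exact Ideal.mul_mem_left _ _ (Ideal.mul_mem_mul (Ideal.mul_mem_mul hu hv) hw)
  convert add_mem (add_mem (sub_mem (mm hx hx hx (x ^ 2)) (mm hx hy hz (3 * x))) (mm hz hz hz 1))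
    (mm hy hy hy x) using 1
  rw [curveElt]; ring

variable [IsNoetherianRing R]

open MvPolynomial in
/-- If `P(a, b, c) dᵉ`, with `P` a form of degree `N` and `a`, `b`, `c` the minors, has order
larger than `2N + 3e`, then the coefficients of `P` lie in `𝔪`. -/
theorem coeff_mem_of_curveElt_pow_mul_aeval_mem (hdim : ringKrullDim R = 3)
    (hm : IsLocalRing.maximalIdeal R = Ideal.span {x, y, z})
    {P : MvPolynomial (Fin 3) R} {N e : ℕ} (hP : P.IsHomogeneous N)
    (h : curveElt x y z ^ e *
      aeval ![x * z - y ^ 2, x ^ 3 - y * z, y * x ^ 2 - z ^ 2] P ∈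
        IsLocalRing.maximalIdeal R ^ (3 * e + 2 * N + 1))
    (i : Fin 3 →₀ ℕ) : P.coeff i ∈ IsLocalRing.maximalIdeal R := by
  -- Surplus factors go into the coefficients, making the minors and `d` values of forms of degree 2
  -- and 3; modulo `𝔪` these reduce to the leading forms and `Z³`.
  let g : Fin 3 → MvPolynomial (Fin 3) R :=
    ![X 0 * X 2 - X 1 ^ 2, C x * X 0 ^ 2 - X 1 * X 2, C y * X 0 ^ 2 - X 2 ^ 2]
  let D : MvPolynomial (Fin 3) R := C (x ^ 2) * X 0 ^ 3 - C (3 * x) * (X 0 * X 1 * X 2) +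
    X 2 ^ 3 + C x * X 1 ^ 3
  have hX (i : Fin 3) : (X i : MvPolynomial (Fin 3) R).IsHomogeneous 1 := isHomogeneous_X R i
  have hg (i : Fin 3) : (g i).IsHomogeneous 2 := by
    fin_cases i
    · exact ((hX 0).mul (hX 2)).sub ((hX 1).pow 2)
    · exact (((hX 0).pow 2).C_mul x).sub ((hX 1).mul (hX 2))
    · exact (((hX 0).pow 2).C_mul y).sub ((hX 2).pow 2)
  have hD : D.IsHomogeneous 3 :=
    (((((hX 0).pow 3).C_mul _).sub ((((hX 0).mul (hX 1)).mul (hX 2)).C_mul _)).add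
      ((hX 2).pow 3)).add (((hX 1).pow 3).C_mul _)
  have hQ : (D ^ e * aeval g P).IsHomogeneous (3 * e + 2 * N) :=
    (hD.pow e).mul (hP.aeval g hg)
  have hev : aeval ![x, y, z] (D ^ e * aeval g P) =
      curveElt x y z ^ e * aeval ![x * z - y ^ 2, x ^ 3 - y * z, y * x ^ 2 - z ^ 2] P := by
    rw [map_mul, map_pow, comp_aeval_apply]
    congr 2
    · simp [D, curveElt]; ring
    · congr 1
      funext i
      fin_cases i
      · simp [g]
      · simp [g]; ring
      · simp [g]
  rw [← hev] at h
  have hcoeff := coeff_mem_maximalIdeal_of_aeval_mem_pow hdim hm hQ h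
  let ρ := IsLocalRing.residue R
  have hρ {r : R} (hr : r ∈ IsLocalRing.maximalIdeal R) : ρ r = 0 :=
    (IsLocalRing.residue_eq_zero_iff r).mpr hr
  have hx : ρ x = 0 := hρ (hm ▸ Ideal.subset_span (by simp))
  have hy : ρ y = 0 := hρ (hm ▸ Ideal.subset_span (by simp))
  have hmap : MvPolynomial.map ρ (D ^ e * aeval g P) = 0 := by
    ext d
    rw [coeff_map, coeff_zero]
    exact hρ (hcoeff d)
  have hmap' : MvPolynomial.map ρ (aeval g P) =
      aeval ![X 0 * X 2 - X 1 ^ 2, -(X 1 * X 2), -X 2 ^ 2] (MvPolynomial.map ρ P) := by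
    rw [aeval_def, eval₂_comp_left, aeval_def, eval₂_map]
    congr 1
    · ext r : 1
      simp [algebraMap_eq]
    · funext i
      fin_cases i <;> simp [g, hx, hy]
  have hDmap : MvPolynomial.map ρ D = X 2 ^ 3 := by
    simp [D, hx]
  rw [map_mul, map_pow, hDmap, hmap', mul_eq_zero,
    or_iff_right (pow_ne_zero _ (pow_ne_zero _ (X_ne_zero 2)))] at hmap
  have hPmap := eq_zero_of_aeval_leadingForms_eq_zero (hP.map ρ) hmap
  rw [← IsLocalRing.residue_eq_zero_iff, ← coeff_map ρ, hPmap, coeff_zero]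

theorem mem_maximalIdeal_mul_of_curveElt_pow_mul_mem (hdim : ringKrullDim R = 3)
    (hm : IsLocalRing.maximalIdeal R = Ideal.span {x, y, z}) {n e : ℕ} {r : R}
    (hr : r ∈ curveIdeal x y z ^ n)
    (h : curveElt x y z ^ e * r ∈ IsLocalRing.maximalIdeal R ^ (3 * e + 2 * n + 1)) :
    r ∈ IsLocalRing.maximalIdeal R * curveIdeal x y z ^ n := by
  obtain ⟨P, hP, rfl⟩ := exists_isHomogeneous_of_mem_curveIdeal_pow hr
  exact aeval_mem_mul_curveIdeal_pow hP (coeff_mem_of_curveElt_pow_mul_aeval_mem hdim hm hP h)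

/-- An element of `∑ₖ dᵏ Iⁿ⁻²ᵏ` whose product with `dᵉ` has order larger than `2n + 3e` lies in
`𝔪 Iⁿ`. -/
theorem mem_of_mem_curveSymbolic_of_curveElt_pow_mul_mem (hdim : ringKrullDim R = 3)
    (hm : IsLocalRing.maximalIdeal R = Ideal.span {x, y, z}) {n e : ℕ} {r : R}
    (hr : r ∈ curveSymbolic x y z n)
    (h : curveElt x y z ^ e * r ∈ IsLocalRing.maximalIdeal R ^ (3 * e + 2 * n + 1)) :
    r ∈ IsLocalRing.maximalIdeal R * curveIdeal x y z ^ n := by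
  induction n using Nat.twoStepInduction generalizing e r with
  | zero => exact mem_maximalIdeal_mul_of_curveElt_pow_mul_mem hdim hm (by simp) h
  | one => exact mem_maximalIdeal_mul_of_curveElt_pow_mul_mem hdim hm (by rwa [pow_one]) h
  | more n ih _ =>
    obtain ⟨f, hf, s, hs, rfl⟩ := exists_of_mem_curveSymbolic hr
    -- This exponent equals `3(e + 1) + 2n + 1`, exactly what the induction hypothesis needs for
    -- `dᵉ⁺¹ s`; then `ds ∈ Iⁿ⁺²`, and `r` itself lies in `Iⁿ⁺²`.
    have hdf : curveElt x y z ^ e * f ∈ IsLocalRing.maximalIdeal R ^ (3 * e + 2 * (n + 2)) := by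
      rw [pow_add, pow_mul, pow_mul]
      exact Ideal.mul_mem_mul (Ideal.pow_mem_pow (curveElt_mem_pow_three hm) e)
        (Ideal.pow_right_mono (curveIdeal_le_pow_two hm) _ hf)
    have hds : curveElt x y z ^ (e + 1) * s ∈
        IsLocalRing.maximalIdeal R ^ (3 * (e + 1) + 2 * n + 1) := by
      have := sub_mem (Ideal.pow_le_pow_right (Nat.le_succ _) h) hdf
      rw [show 3 * (e + 1) + 2 * n + 1 = 3 * e + 2 * (n + 2) by ring]
      convert this using 1
      ring
    have hs' := ih hs hds
    refine mem_maximalIdeal_mul_of_curveElt_pow_mul_mem hdim hm (add_mem hf ?_) h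
    exact curveElt_mul_mem_curveIdeal_pow (hm ▸ hs')

end Order

end Curve

/-! ### `x` is a nonzerodivisor modulo `Sₙ`. -/

section Saturation

variable {R : Type*} [CommRing R] {x y z : R}

/-- Modulo `d` one has `b² = ac`, `bc = -xa²`, `c² = -xab`, so `I² ⊆ aI + (d)`; iterate. -/
theorem curveIdeal_pow_le (n : ℕ) : curveIdeal x y z ^ (n + 2) ≤
    Ideal.span {(x * z - y ^ 2) ^ (n + 1)} * curveIdeal x y z ⊔
      Ideal.span {curveElt x y z} * curveSymbolic x y z n := by
  have hsq : curveIdeal x y z ^ 2 ≤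
      Ideal.span {x * z - y ^ 2} * curveIdeal x y z ⊔ Ideal.span {curveElt x y z} := by
    rw [pow_two]
    refine Ideal.mul_le.mpr fun u hu v hv => ?_
    obtain ⟨u₀, u₁, u₂, rfl⟩ := exists_of_mem_curveIdeal hu
    obtain ⟨v₀, v₁, v₂, rfl⟩ := exists_of_mem_curveIdeal hv
    have hw : u₀ * (v₀ * (x * z - y ^ 2) + v₁ * (x ^ 3 - y * z) + v₂ * (y * x ^ 2 - z ^ 2)) +
        (u₁ * v₀ - u₂ * v₂ * x) * (x ^ 3 - y * z) + (u₂ * v₀ + u₁ * v₁) * (y * x ^ 2 - z ^ 2) -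
          (u₁ * v₂ + u₂ * v₁) * x * (x * z - y ^ 2) ∈ curveIdeal x y z :=
      sub_mem (add_mem (add_mem (Ideal.mul_mem_left _ _ hv) (Ideal.mul_mem_left _ _ minor_one_mem))
        (Ideal.mul_mem_left _ _ minor_two_mem)) (Ideal.mul_mem_left _ _ minor_zero_mem)
    convert Submodule.add_mem_sup (Ideal.mul_mem_mul (Ideal.mem_span_singleton_self _) hw)
      (Ideal.mul_mem_left _ (u₁ * v₁ * x + (u₁ * v₂ + u₂ * v₁) * y + u₂ * v₂ * z)
        (Ideal.mem_span_singleton_self (curveElt x y z))) using 1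
    rw [curveElt]
    ring
  induction n with
  | zero => simpa [curveSymbolic] using hsq
  | succ n ih =>
    rw [show n + 1 + 2 = (n + 2) + 1 by ring, pow_succ']
    refine (Ideal.mul_mono_right ih).trans ?_
    rw [Ideal.mul_sup]
    refine sup_le ?_ ?_
    · rw [mul_left_comm, ← pow_two]
      refine (Ideal.mul_mono_right hsq).trans ?_
      rw [Ideal.mul_sup, ← mul_assoc, Ideal.span_singleton_mul_span_singleton, ← pow_succ]
      refine sup_le_sup_left ?_ _
      rw [mul_comm]
      refine Ideal.mul_mono_right ?_
      rw [Ideal.span_singleton_le_iff_mem]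
      exact pow_le_curveSymbolic _ (Ideal.pow_mem_pow minor_zero_mem _)
    · rw [mul_left_comm]
      exact le_sup_of_le_right (Ideal.mul_mono_right (curveIdeal_mul_curveSymbolic_le n))

theorem minor_zero_notMem_span_pair (hxz : (Ideal.span {x, z}).IsPrime)
    (hy : y ∉ Ideal.span {x, z}) : x * z - y ^ 2 ∉ Ideal.span {x, z} := fun h => by
  refine hy (hxz.mem_of_pow_mem 2 ?_)
  have := sub_mem (Ideal.mul_mem_right z _ (Ideal.subset_span (Set.mem_insert x {z}))) h
  simpa using this

/-- Reduction modulo the syzygies of the minors, up to multiples of `x`. -/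
theorem exists_of_add_curveElt_mul_mem_span (hx : (Ideal.span {x}).IsPrime)
    (hxz : (Ideal.span {x, z}).IsPrime) (hz : z ∉ Ideal.span {x}) (hy : y ∉ Ideal.span {x, z})
    {n : ℕ} {w s : R} (hw : w ∈ curveIdeal x y z)
    (h : (x * z - y ^ 2) ^ n * w + curveElt x y z * s ∈ Ideal.span {x}) :
    ∃ v ∈ curveIdeal x y z, ∃ t,
      (x * z - y ^ 2) ^ n * w =
        x * ((x * z - y ^ 2) ^ n * v) + t * (x * z - y ^ 2) ^ n * (y * x ^ 2 - z ^ 2) := by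
  obtain ⟨r₀, r₁, r₂, rfl⟩ := exists_of_mem_curveIdeal hw
  have ha := minor_zero_notMem_span_pair hxz hy
  obtain ⟨q, hq⟩ := Ideal.mem_span_singleton'.mp h
  have mem_pair (u v : R) : u * x + v * z ∈ Ideal.span {x, z} :=
    Ideal.mem_span_pair.mpr ⟨u, v, rfl⟩
  -- Modulo `(x, z)` the elements `b`, `c`, `d` vanish and `a` does not.
  have h0 : r₀ ∈ Ideal.span {x, z} := by
    have : (x * z - y ^ 2) ^ (n + 1) * r₀ ∈ Ideal.span {x, z} := by
      convert mem_pair (q - (x * z - y ^ 2) ^ n * (r₁ * x ^ 2 + r₂ * (y * x)) -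
          s * (x ^ 4 - 3 * x * y * z + y ^ 3))
        ((x * z - y ^ 2) ^ n * (r₁ * y + r₂ * z) - s * z ^ 2) using 1
      rw [curveElt] at hq
      linear_combination -hq
    exact (hxz.mem_or_mem this).resolve_left fun h' => ha (hxz.mem_of_pow_mem _ h')
  obtain ⟨u₀, v₀, rfl⟩ := Ideal.mem_span_pair.mp h0
  -- The syzygy `za = yb - xc` moves `v₀za` into the other terms. Modulo `x` what remains is
  -- divisible by `z`, as `b ≡ -yz`, `c ≡ -z²`, `d ≡ z³`; cancel `z` and reduce modulo `(x, z)`.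
  have h1 : r₁ + v₀ * y ∈ Ideal.span {x, z} := by
    have hdiv : z * ((x * z - y ^ 2) ^ n * (-(r₁ + v₀ * y) * y - r₂ * z) + z ^ 2 * s) ∈
        Ideal.span {x} := by
      refine Ideal.mem_span_singleton'.mpr ⟨q - (x * z - y ^ 2) ^ n *
        (u₀ * (x * z - y ^ 2) - v₀ * (y * x ^ 2 - z ^ 2) + (r₁ + v₀ * y) * x ^ 2 + r₂ * y * x) -
          s * (x ^ 4 - 3 * x * y * z + y ^ 3), ?_⟩
      rw [curveElt] at hq
      linear_combination hq
    obtain ⟨q', hq'⟩ := Ideal.mem_span_singleton'.mp ((hx.mem_or_mem hdiv).resolve_left hz)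
    have : (x * z - y ^ 2) ^ n * y * (r₁ + v₀ * y) ∈ Ideal.span {x, z} := by
      convert mem_pair (-q') (-(x * z - y ^ 2) ^ n * r₂ + z * s) using 1
      linear_combination hq'
    refine (hxz.mem_or_mem this).resolve_left fun h' => ?_
    exact (hxz.mem_or_mem h').elim (fun h'' => ha (hxz.mem_of_pow_mem _ h'')) hy
  obtain ⟨u₁, v₁, hr₁⟩ := Ideal.mem_span_pair.mp h1
  -- The second syzygy `zb = yc + x²a` removes `v₁zb`.
  refine ⟨(u₀ + v₁ * x) * (x * z - y ^ 2) + u₁ * (x ^ 3 - y * z) - v₀ * (y * x ^ 2 - z ^ 2),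
    sub_mem (add_mem (Ideal.mul_mem_left _ _ minor_zero_mem) (Ideal.mul_mem_left _ _ minor_one_mem))
      (Ideal.mul_mem_left _ _ minor_two_mem), r₂ + v₁ * y, ?_⟩
  linear_combination (-(x * z - y ^ 2) ^ n * (x ^ 3 - y * z)) * hr₁

/-- In normal form, `r = aⁿ⁺¹w + ds` at level `n + 2`. The syzygies strip `w` to `tc` up to
multiples of `x`, comparison modulo `x` puts `t` in `(x, z)`, and the rest is `d` times an element
of `Sₙ`, where induction applies. -/
theorem exists_mul_eq_of_mem_curveSymbolic (hx : (Ideal.span {x}).IsPrime)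
    (hxz : (Ideal.span {x, z}).IsPrime) (hz : z ∉ Ideal.span {x}) (hy : y ∉ Ideal.span {x, z})
    {n : ℕ} {r : R} (hr : r ∈ curveSymbolic x y z n) (hrx : r ∈ Ideal.span {x}) :
    ∃ s ∈ curveSymbolic x y z n, r = x * s := by
  have hxx (t : R) : t * x ∈ Ideal.span {x} := Ideal.mem_span_singleton'.mpr ⟨t, rfl⟩
  induction n using Nat.twoStepInduction generalizing r with
  | zero =>
    obtain ⟨s, rfl⟩ := Ideal.mem_span_singleton.mp hrx
    exact ⟨s, trivial, rfl⟩
  | one =>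
    obtain ⟨v, hv, t, ht⟩ := exists_of_add_curveElt_mul_mem_span hx hxz hz hy (n := 0) (w := r)
      (s := 0) hr (by simpa using hrx)
    simp only [pow_zero, one_mul, mul_one] at ht
    have htx : t ∈ Ideal.span {x} := by
      have h1 : z ^ 2 * t ∈ Ideal.span {x} := by
        convert sub_mem (hxx (v + t * y * x)) hrx using 1
        linear_combination ht
      exact (hx.mem_or_mem h1).resolve_left fun h' => hz (hx.mem_of_pow_mem _ h')
    obtain ⟨u, rfl⟩ := Ideal.mem_span_singleton.mp htx
    exact ⟨v + u * (y * x ^ 2 - z ^ 2),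
      add_mem hv (Ideal.mul_mem_left _ _ minor_two_mem), by rw [ht]; ring⟩
  | more n ih _ =>
    obtain ⟨f, hf, s, hs, rfl⟩ := exists_of_mem_curveSymbolic hr
    obtain ⟨g, hg, e, he, rfl⟩ := Submodule.mem_sup.mp (curveIdeal_pow_le n hf)
    obtain ⟨w, hw, rfl⟩ := Ideal.mem_span_singleton_mul.mp hg
    obtain ⟨s', hs', rfl⟩ := Ideal.mem_span_singleton_mul.mp he
    rw [add_assoc, ← mul_add] at hrx ⊢
    obtain ⟨v, hv, t, ht⟩ := exists_of_add_curveElt_mul_mem_span hx hxz hz hy hw hrx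
    rw [ht] at hrx ⊢
    obtain ⟨q, hq⟩ := Ideal.mem_span_singleton'.mp hrx
    -- Modulo `x`, `c ≡ -z²` and `d ≡ z³`, so `z²` cancels.
    have htx : t ∈ Ideal.span {x, z} := by
      have hdiv : z ^ 2 * (z * (s' + s) - t * (x * z - y ^ 2) ^ (n + 1)) ∈ Ideal.span {x} := by
        refine Ideal.mem_span_singleton'.mpr ⟨q - (x * z - y ^ 2) ^ (n + 1) * (v + t * y * x) -
          (s' + s) * (x ^ 4 - 3 * x * y * z + y ^ 3), ?_⟩
        rw [curveElt] at hq
        linear_combination hq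
      obtain ⟨q', hq'⟩ := Ideal.mem_span_singleton'.mp
        ((hx.mem_or_mem hdiv).resolve_left fun h' => hz (hx.mem_of_pow_mem _ h'))
      have : (x * z - y ^ 2) ^ (n + 1) * t ∈ Ideal.span {x, z} :=
        Ideal.mem_span_pair.mpr ⟨-q', s' + s, by linear_combination -hq'⟩
      exact (hxz.mem_or_mem this).resolve_left fun h' =>
        minor_zero_notMem_span_pair hxz hy (hxz.mem_of_pow_mem _ h')
    obtain ⟨u, k, rfl⟩ := Ideal.mem_span_pair.mp htx
    have hd : curveElt x y z ∉ Ideal.span {x} := fun h => by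
      refine hz (hx.mem_of_pow_mem 3 ?_)
      convert sub_mem h (hxx (x ^ 4 - 3 * x * y * z + y ^ 3)) using 1
      rw [curveElt]; ring
    -- From `za = yb - xc` and `bc = yd - xa²`, `z aⁿ⁺¹ c = aⁿ y² d - x aⁿ (y a² + c²)`: the
    -- remaining term is absorbed into the multiple of `d`.
    have hs'' : k * (x * z - y ^ 2) ^ n * y ^ 2 + (s' + s) ∈ curveSymbolic x y z n :=
      add_mem (Ideal.mul_mem_right _ _ (Ideal.mul_mem_left _ _
        (pow_le_curveSymbolic _ (Ideal.pow_mem_pow minor_zero_mem _)))) (add_mem hs' hs)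
    have hmul : curveElt x y z * (k * (x * z - y ^ 2) ^ n * y ^ 2 + (s' + s)) ∈
        Ideal.span {x} := by
      refine Ideal.mem_span_singleton'.mpr ⟨q - (x * z - y ^ 2) ^ (n + 1) *
        (v + u * (y * x ^ 2 - z ^ 2)) + k * (x * z - y ^ 2) ^ n *
          (y * (x * z - y ^ 2) ^ 2 + (y * x ^ 2 - z ^ 2) ^ 2), ?_⟩
      rw [curveElt] at hq ⊢
      linear_combination hq
    obtain ⟨p, hp, hpeq⟩ := ih hs'' ((hx.mem_or_mem hmul).resolve_left hd)
    have hpow (i j : ℕ) (hij : i + j = n + 2) {c : R} (hc : c ∈ curveIdeal x y z ^ j) :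
        (x * z - y ^ 2) ^ i * c ∈ curveSymbolic x y z (n + 2) := by
      refine pow_le_curveSymbolic _ ?_
      rw [← hij, pow_add]
      exact Ideal.mul_mem_mul (Ideal.pow_mem_pow minor_zero_mem _) hc
    have hv' : v + u * (y * x ^ 2 - z ^ 2) ∈ curveIdeal x y z ^ 1 := by
      rw [pow_one]
      exact add_mem hv (Ideal.mul_mem_left _ _ minor_two_mem)
    have hsq : k * (y * (x * z - y ^ 2) ^ 2 + (y * x ^ 2 - z ^ 2) ^ 2) ∈ curveIdeal x y z ^ 2 :=
      Ideal.mul_mem_left _ _ (add_mem (Ideal.mul_mem_left _ _ (Ideal.pow_mem_pow minor_zero_mem _))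
        (Ideal.pow_mem_pow minor_two_mem _))
    refine ⟨_, add_mem (sub_mem (hpow (n + 1) 1 rfl hv') (hpow n 2 rfl hsq))
      (curveElt_mul_mem hp), ?_⟩
    rw [curveElt] at *
    linear_combination (x ^ 5 - 3 * x ^ 2 * y * z + z ^ 3 + x * y ^ 3) * hpeq

end Saturation

/-! ### Identification of the symbolic powers. -/

section SymbolicPower

variable {R : Type*} [CommRing R] [IsLocalRing R] [IsNoetherianRing R] {x y z : R}

theorem mem_curveSymbolic_of_pow_mul_mem (hdim : ringKrullDim R = 3)
    (hm : IsLocalRing.maximalIdeal R = Ideal.span {x, y, z}) {n k : ℕ} {r : R}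
    (h : x ^ k * r ∈ curveSymbolic x y z n) : r ∈ curveSymbolic x y z n := by
  obtain ⟨p0, p1, p2, hx, hz, hy⟩ := isPrime_of_regular_parameters hdim hm
  have : IsDomain R := IsDomain.of_bot_isPrime R
  induction k with
  | zero => simpa using h
  | succ k ih =>
    rw [pow_succ', mul_assoc] at h
    obtain ⟨s, hs, hrs⟩ := exists_mul_eq_of_mem_curveSymbolic p1 p2 hz hy h
      (Ideal.mul_mem_right _ _ (Ideal.mem_span_singleton_self x))
    exact ih (mul_left_cancel₀ hx hrs ▸ hs)

omit [IsLocalRing R] [IsNoetherianRing R] in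
theorem exists_pow_mul_mem_curveIdeal_pow {n : ℕ} {r : R} (h : r ∈ curveSymbolic x y z n) :
    ∃ k, x ^ k * r ∈ curveIdeal x y z ^ n := by
  induction n using Nat.twoStepInduction generalizing r with
  | zero => exact ⟨0, by simp⟩
  | one => exact ⟨0, by rw [pow_zero, one_mul, pow_one]; exact h⟩
  | more n ih _ =>
    obtain ⟨f, hf, s, hs, rfl⟩ := exists_of_mem_curveSymbolic h
    obtain ⟨k, hk⟩ := ih hs
    refine ⟨k + 1, ?_⟩
    have h1 := Ideal.mul_mem_mul (mul_curveElt_mem (x := x) (y := y) (z := z) (r := x)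
      (Ideal.subset_span (by simp))) hk
    rw [← pow_add, add_comm 2 n] at h1
    convert add_mem (Ideal.mul_mem_left _ (x ^ (k + 1)) hf) h1 using 1
    ring

omit [IsNoetherianRing R] in
theorem eq_maximalIdeal_of_curveIdeal_le
    (hm : IsLocalRing.maximalIdeal R = Ideal.span {x, y, z}) {Q : Ideal R} (hQ : Q.IsPrime)
    (hIQ : curveIdeal x y z ≤ Q) (hx : x ∈ Q) : Q = IsLocalRing.maximalIdeal R := by
  refine le_antisymm (IsLocalRing.le_maximalIdeal hQ.ne_top) ?_
  have hy : y ∈ Q := hQ.mem_of_pow_mem 2 (by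
    convert sub_mem (Ideal.mul_mem_right z _ hx) (hIQ minor_zero_mem) using 1; ring)
  have hz : z ∈ Q := hQ.mem_of_pow_mem 2 (by
    convert sub_mem (Ideal.mul_mem_right (y * x) _ hx) (hIQ minor_two_mem) using 1; ring)
  rw [hm, Ideal.span_le]
  rintro r (hr | hr | hr) <;> rw [hr]
  exacts [hx, hy, hz]

/-- Otherwise `𝔪` is the only prime over `I`, some `xᵏ` lies in `I = S₁`, and cancelling `x` gives
`1 ∈ I`. -/
theorem notMem_of_mem_minimalPrimes_curveIdeal (hdim : ringKrullDim R = 3)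
    (hm : IsLocalRing.maximalIdeal R = Ideal.span {x, y, z}) {p : Ideal R}
    (hp : p ∈ (curveIdeal x y z).minimalPrimes) : x ∉ p := fun hx => by
  have hpm := eq_maximalIdeal_of_curveIdeal_le hm hp.1.1 hp.1.2 hx
  have hrad : x ∈ (curveIdeal x y z).radical := by
    rw [Ideal.radical_eq_sInf, Submodule.mem_sInf]
    rintro Q ⟨hIQ, hQ⟩
    exact hp.2 ⟨hQ, hIQ⟩ (hpm ▸ IsLocalRing.le_maximalIdeal hQ.ne_top) hx
  obtain ⟨k, hk⟩ := hrad
  have h1 : (1 : R) ∈ curveSymbolic x y z 1 :=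
    mem_curveSymbolic_of_pow_mul_mem hdim hm (k := k) (by rwa [mul_one])
  exact hp.1.1.ne_top ((Ideal.eq_top_iff_one p).mpr (hp.1.2 h1))

/-- A prime strictly containing a prime `p ⊇ I` contains `x`. -/
theorem mem_of_lt_of_curveIdeal_le (hm : IsLocalRing.maximalIdeal R = Ideal.span {x, y, z})
    {p Q : Ideal R} (hp : p.IsPrime) (hQ : Q.IsPrime) (hIp : curveIdeal x y z ≤ p) (hpQ : p < Q) :
    x ∈ Q := by
  by_contra hxQ
  have hxm : x ∈ IsLocalRing.maximalIdeal R := hm ▸ Ideal.subset_span (by simp)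
  obtain ⟨s, hsQ, hsp⟩ := Set.exists_of_ssubset hpQ
  -- Only `𝔪` contains `p + (x)`, so `dim R ⧸ p ≤ 1`; but `p < Q` with `x ∉ Q` would give dimension
  -- at least 2.
  have h0 : ringKrullDim (R ⧸ p ⊔ Ideal.span {x}) ≤ 0 := by
    rw [ringKrullDim_quotient]
    have : Subsingleton (PrimeSpectrum.zeroLocus ((p ⊔ Ideal.span {x} : Ideal R) : Set R)) := by
      have key (q : PrimeSpectrum.zeroLocus ((p ⊔ Ideal.span {x} : Ideal R) : Set R)) :
          q.1.asIdeal = IsLocalRing.maximalIdeal R :=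
        have hq : p ⊔ Ideal.span {x} ≤ q.1.asIdeal := q.2
        eq_maximalIdeal_of_curveIdeal_le hm q.1.isPrime ((hIp.trans le_sup_left).trans hq)
          (hq (Ideal.mem_sup_right (Ideal.mem_span_singleton_self x)))
      exact ⟨fun q q' => Subtype.ext (PrimeSpectrum.ext ((key q).trans (key q').symm))⟩
    exact Order.krullDim_nonpos_of_subsingleton
  have hmax {J K : Ideal R} (h : J ≤ K) : ringKrullDim (R ⧸ K) ≤ ringKrullDim (R ⧸ J) :=
    ringKrullDim_le_of_surjective (Ideal.Quotient.factor h) (Ideal.Quotient.factor_surjective _)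
  have h1 := ringKrullDim_quotient_le_quotient_sup_span_add_one hp.ne_top hxm
  have h2 := ringKrullDim_quotient_sup_span_add_one_le hp hsp
  have h3 := ringKrullDim_quotient_sup_span_add_one_le hQ hxQ
  have h4 := hmax (sup_le hpQ.le ((Ideal.span_singleton_le_iff_mem _).mpr hsQ))
  have h5 : (0 : WithBot ℕ∞) ≤ ringKrullDim (R ⧸ Q ⊔ Ideal.span {x}) := by
    have : Nontrivial (R ⧸ Q ⊔ Ideal.span {x}) := Ideal.Quotient.nontrivial_iff.mpr
      (ne_top_of_le_ne_top (IsLocalRing.maximalIdeal.isMaximal R).ne_top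
        (sup_le (IsLocalRing.le_maximalIdeal hQ.ne_top)
          ((Ideal.span_singleton_le_iff_mem _).mpr hxm)))
    exact ringKrullDim_nonneg_of_nontrivial
  have h6 : (0 + 1 + 1 : WithBot ℕ∞) ≤ 0 + 1 :=
    (add_le_add_left ((add_le_add_left h5 1).trans (h3.trans h4)) 1).trans
      (h2.trans (h1.trans (add_le_add_left h0 1)))
  exact absurd h6 (by decide)

/-- The symbolic powers of `I = curveIdeal x y z` are the ideals `∑ₖ dᵏ Iⁿ⁻²ᵏ`. -/
theorem symbolicPower_curveIdeal (hdim : ringKrullDim R = 3)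
    (hm : IsLocalRing.maximalIdeal R = Ideal.span {x, y, z}) (n : ℕ) :
    symbolicPower (curveIdeal x y z) n = curveSymbolic x y z n := by
  have hmem (r : R) : r ∈ symbolicPower (curveIdeal x y z) n ↔
      ∀ p ∈ (curveIdeal x y z).minimalPrimes, ∃ t ∉ p, t * r ∈ curveIdeal x y z ^ n := by
    rw [symbolicPower, Submodule.mem_iInf]
    constructor
    · intro h p hp
      have h1 := h ⟨⟨p, hp.1.1⟩, hp⟩
      rw [Ideal.mem_comap, IsLocalization.algebraMap_mem_map_algebraMap_iff
        (M := Ideal.primeCompl p (hp := hp.1.1))] at h1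
      exact h1
    · rintro h ⟨p, hp⟩
      rw [Ideal.mem_comap, IsLocalization.algebraMap_mem_map_algebraMap_iff
        (M := Ideal.primeCompl p.asIdeal)]
      exact h _ hp
  ext r
  rw [hmem]
  constructor
  · intro h
    -- `K` is the colon ideal `Sₙ : r`. A prime over it contains a minimal prime of `I`, strictly by
    -- the choice of `t`, hence contains `x`; so `xᵏr ∈ Sₙ` for some `k`.
    let K : Ideal R := Submodule.comap (LinearMap.mulRight R r) (curveSymbolic x y z n)
    have hK {t : R} : t ∈ K ↔ t * r ∈ curveSymbolic x y z n := Iff.rfl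
    have hrad : x ∈ K.radical := by
      rw [Ideal.radical_eq_sInf, Submodule.mem_sInf]
      rintro Q ⟨hKQ, hQ⟩
      have hIQ : curveIdeal x y z ≤ Q := hQ.le_of_pow_le (n := n) fun t ht =>
        hKQ (hK.mpr (pow_le_curveSymbolic n (Ideal.mul_mem_right r _ ht)))
      obtain ⟨p, hp, hpQ⟩ := Ideal.exists_minimalPrimes_le hIQ
      obtain ⟨t, htp, ht⟩ := h p hp
      refine mem_of_lt_of_curveIdeal_le hm hp.1.1 hQ hp.1.2 (lt_of_le_of_ne hpQ ?_)
      rintro rfl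
      exact htp (hKQ (hK.mpr (pow_le_curveSymbolic n ht)))
    obtain ⟨k, hk⟩ := hrad
    exact mem_curveSymbolic_of_pow_mul_mem hdim hm (hK.mp hk)
  · intro h p hp
    obtain ⟨k, hk⟩ := exists_pow_mul_mem_curveIdeal_pow h
    exact ⟨x ^ k, fun h' => notMem_of_mem_minimalPrimes_curveIdeal hdim hm hp
      (hp.1.1.mem_of_pow_mem k h'), hk⟩

end SymbolicPower

/-! ### The binomial sum and its asymptotics. -/

section ClosedForm

/-- Splitting off `k = 1` reproduces the recursion for the lengths. -/
theorem sum_choose_add_two (n : ℕ) :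
    ∑ k ∈ Finset.Icc 1 ((n + 2) / 2), (n + 2 - 2 * k + 2).choose 2 =
      (n + 2).choose 2 + ∑ k ∈ Finset.Icc 1 (n / 2), (n - 2 * k + 2).choose 2 := by
  have hIcc (m : ℕ) : Finset.Icc 1 m = Finset.Ico 1 (m + 1) := by ext; simp
  rw [hIcc, hIcc, Finset.sum_Ico_eq_sum_range, Finset.sum_Ico_eq_sum_range,
    show (n + 2) / 2 + 1 - 1 = n / 2 + 1 - 1 + 1 by omega, Finset.sum_range_succ', add_comm]
  congr 1
  exact Finset.sum_congr rfl fun k _ => by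
    rw [show n + 2 - 2 * (1 + (k + 1)) = n - 2 * (1 + k) by omega]

theorem cast_choose_three (K : Type*) [Field K] [CharZero K] (n : ℕ) :
    ((n + 2).choose 3 : K) = (n + 2) * (n + 1) * n / 6 := by
  induction n with
  | zero => simp
  | succ n ih =>
    rw [show n + 1 + 2 = (n + 2) + 1 by ring, Nat.choose_succ_succ, Nat.cast_add, ih,
      Nat.cast_choose_two]
    push_cast
    field_simp
    ring

theorem cast_sum_choose (K : Type*) [Field K] [CharZero K] (n : ℕ) :
    ((∑ k ∈ Finset.Icc 1 (n / 2), (n - 2 * k + 2).choose 2 : ℕ) : K) =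
      1 / 2 * ((n + 2).choose 3 : K) - 1 / 4 * ((n + 1).choose 2 : K) - 1 / 8 * (n : K) -
        if Odd n then 1 / 8 else 0 := by
  induction n using Nat.twoStepInduction with
  | zero => simp
  | one => norm_num
  | more n ih _ =>
    rw [sum_choose_add_two, Nat.cast_add, ih]
    simp only [Nat.odd_add, even_two, iff_true]
    rw [cast_choose_three, cast_choose_three, Nat.cast_choose_two, Nat.cast_choose_two,
      Nat.cast_choose_two]
    push_cast
    field_simp
    ring

theorem tendsto_sum_choose :
    Tendsto (fun n : ℕ => ((Nat.factorial 3 : ℕ) : ℝ) / (n : ℝ) ^ 3 *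
      ((∑ k ∈ Finset.Icc 1 (n / 2), (n - 2 * k + 2).choose 2 : ℕ) : ℝ)) atTop (𝓝 (1 / 2)) := by
  have hu : Tendsto (fun n : ℕ => 1 / (n : ℝ)) atTop (𝓝 0) := tendsto_one_div_atTop_nhds_zero_nat
  have hδ : Tendsto (fun n : ℕ => (if Odd n then 1 else 0) * (1 / (n : ℝ))) atTop (𝓝 0) := by
    refine squeeze_zero (fun n => by positivity) (fun n => ?_) hu
    have : (0 : ℝ) ≤ 1 / n := by positivity
    split_ifs <;> linarith
  -- This is `6 / n³` times the closed form, expanded in `1 / n`.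
  have hlim : Tendsto (fun n : ℕ => 1 / 2 + 3 / 4 * (1 / (n : ℝ)) - 1 / 2 * (1 / (n : ℝ)) ^ 2 -
      3 / 4 * ((if Odd n then 1 else 0) * (1 / (n : ℝ))) * (1 / (n : ℝ)) ^ 2) atTop (𝓝 (1 / 2)) := by
    have := ((tendsto_const_nhds (x := (1 / 2 : ℝ))).add (hu.const_mul (3 / 4))).sub
      ((hu.pow 2).const_mul (1 / 2)) |>.sub ((hδ.const_mul (3 / 4)).mul (hu.pow 2))
    simpa using this
  refine hlim.congr' ?_
  filter_upwards [eventually_ge_atTop 1] with n hn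
  have hn0 : (n : ℝ) ≠ 0 := by positivity
  rw [cast_sum_choose, cast_choose_three, Nat.cast_choose_two,
    show ((Nat.factorial 3 : ℕ) : ℝ) = 6 by norm_num [Nat.factorial]]
  push_cast
  split_ifs <;> field_simp <;> ring

end ClosedForm

/-! ### Computation of the lengths. -/

section Length

variable {R : Type*} [CommRing R]

theorem length_quotient_submoduleOf_add {M : Type*} [AddCommGroup M] [Module R M]
    {K L J : Submodule R M} (hKL : K ≤ L) (hLJ : L ≤ J) :
    Module.length R (J ⧸ K.submoduleOf J) =
      Module.length R (L ⧸ K.submoduleOf L) + Module.length R (J ⧸ L.submoduleOf J) := by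
  have h1 : K.submoduleOf L ≤ (K.submoduleOf J).comap (Submodule.inclusion hLJ) := fun _ h => h
  have h2 : K.submoduleOf J ≤ L.submoduleOf J := fun _ h => hKL h
  refine Module.length_eq_add_of_exact (Submodule.mapQ _ _ (Submodule.inclusion hLJ) h1)
    (Submodule.factor h2) ?_ (Submodule.factor_surjective h2) ?_
  · rw [← LinearMap.ker_eq_bot, Submodule.ker_mapQ]
    exact (Submodule.mkQ_map_self _)
  · intro q
    obtain ⟨⟨j, hj⟩, rfl⟩ := Submodule.Quotient.mk_surjective _ q
    constructor
    · intro h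
      have hjL : j ∈ L := (Submodule.Quotient.mk_eq_zero (L.submoduleOf J)).mp h
      exact ⟨Submodule.Quotient.mk ⟨j, hjL⟩, rfl⟩
    · rintro ⟨l, hl⟩
      obtain ⟨⟨l, hlL⟩, rfl⟩ := Submodule.Quotient.mk_surjective _ l
      rw [← hl]
      exact (Submodule.Quotient.mk_eq_zero (L.submoduleOf J)).mpr hlL

theorem length_quotient_ker_eq {M N : Type*} [AddCommGroup M] [Module R M] [AddCommGroup N]
    [Module R N] {K : Submodule R M} (f : M →ₗ[R] N) (hf : Function.Surjective f)
    (hK : LinearMap.ker f = K) : Module.length R (M ⧸ K) = Module.length R N := by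
  subst hK
  exact (f.quotKerEquivOfSurjective hf).length_eq

variable [IsLocalRing R] [IsNoetherianRing R] {x y z : R}

/-- The ideal `Iⁿ` has `(n + 2).choose 2` minimal generators. -/
theorem length_curveIdeal_pow_quotient (hdim : ringKrullDim R = 3)
    (hm : IsLocalRing.maximalIdeal R = Ideal.span {x, y, z}) (n : ℕ) :
    Module.length R (↥(curveIdeal x y z ^ n) ⧸
      (IsLocalRing.maximalIdeal R * curveIdeal x y z ^ n).submoduleOf (curveIdeal x y z ^ n)) =
        ((n + 2).choose 2 : ℕ) := by
  classical
  -- A finite type indexing the monomials of degree `n`. The maps `Φ` and `Ψ` below are surjections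
  -- from `S → R` with equal kernels, onto `Iⁿ / 𝔪Iⁿ` and a power of the residue field.
  let S := Sym (Fin 3) n
  let ε : S → (Fin 3 →₀ ℕ) := fun s => Multiset.toFinsupp s.1
  have hε : Function.Injective ε := fun s t h => Subtype.ext (Multiset.toFinsupp.injective h)
  have hεdeg (s : S) : (ε s).degree = n := by
    rw [Finsupp.degree_apply]
    exact (Multiset.toFinsupp_sum_eq s.1).trans s.2
  have hεsurj (d : Fin 3 →₀ ℕ) (hd : d.degree = n) : ∃ s, ε s = d := by
    refine ⟨⟨Finsupp.toMultiset d, ?_⟩, Finsupp.toMultiset_toFinsupp d⟩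
    rw [Finsupp.card_toMultiset, ← hd, Finsupp.degree_apply]
    rfl
  let Pol : (S → R) →ₗ[R] MvPolynomial (Fin 3) R :=
    ∑ s, MvPolynomial.monomial (ε s) ∘ₗ LinearMap.proj s
  have hPol (c : S → R) : Pol c = ∑ s, MvPolynomial.monomial (ε s) (c s) := by
    simp [Pol]
  have hcoeff (c : S → R) (s : S) : (Pol c).coeff (ε s) = c s := by
    rw [hPol, MvPolynomial.coeff_sum, Finset.sum_eq_single s]
    · rw [MvPolynomial.coeff_monomial, if_pos rfl]
    · intro t _ hts
      rw [MvPolynomial.coeff_monomial, if_neg fun h => hts (hε h)]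
    · simp
  have hhom (c : S → R) : (Pol c).IsHomogeneous n := by
    rw [hPol]
    exact MvPolynomial.IsHomogeneous.sum _ _ _ fun s _ =>
      MvPolynomial.isHomogeneous_monomial _ (hεdeg s)
  have hmem (c : S → R) : MvPolynomial.aeval
      ![x * z - y ^ 2, x ^ 3 - y * z, y * x ^ 2 - z ^ 2] (Pol c) ∈ curveIdeal x y z ^ n :=
    (Ideal.mem_span_pow_iff_exists_isHomogeneous _ _).mpr ⟨_, hhom c, rfl⟩
  let Φ : (S → R) →ₗ[R] ↥(curveIdeal x y z ^ n) ⧸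
      (IsLocalRing.maximalIdeal R * curveIdeal x y z ^ n).submoduleOf (curveIdeal x y z ^ n) :=
    Submodule.mkQ _ ∘ₗ LinearMap.codRestrict (curveIdeal x y z ^ n)
      ((MvPolynomial.aeval
        ![x * z - y ^ 2, x ^ 3 - y * z, y * x ^ 2 - z ^ 2]).toLinearMap ∘ₗ Pol) hmem
  let Ψ : (S → R) →ₗ[R] (S → R ⧸ IsLocalRing.maximalIdeal R) :=
    LinearMap.pi fun s => (IsLocalRing.maximalIdeal R).mkQ ∘ₗ LinearMap.proj s
  have hΨker (c : S → R) : c ∈ LinearMap.ker Ψ ↔ ∀ s, c s ∈ IsLocalRing.maximalIdeal R := by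
    rw [LinearMap.mem_ker, funext_iff]
    exact forall_congr' fun s => Submodule.Quotient.mk_eq_zero _
  have hΦker : LinearMap.ker Φ = LinearMap.ker Ψ := by
    ext c
    have : c ∈ LinearMap.ker Φ ↔ MvPolynomial.aeval
        ![x * z - y ^ 2, x ^ 3 - y * z, y * x ^ 2 - z ^ 2] (Pol c) ∈
          IsLocalRing.maximalIdeal R * curveIdeal x y z ^ n :=
      LinearMap.mem_ker.trans (Submodule.Quotient.mk_eq_zero _)
    rw [this, hΨker]
    constructor
    · intro h s
      rw [← hcoeff c s]
      refine coeff_mem_of_curveElt_pow_mul_aeval_mem (e := 0) hdim hm (hhom c) ?_ _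
      rw [pow_zero, one_mul, mul_zero, zero_add, pow_succ', pow_mul]
      exact Ideal.mul_mono_right (Ideal.pow_right_mono (curveIdeal_le_pow_two hm) n) h
    · intro h
      refine aeval_mem_mul_curveIdeal_pow (hhom c) fun d => ?_
      rw [hPol, MvPolynomial.coeff_sum]
      refine Ideal.sum_mem _ fun s _ => ?_
      rw [MvPolynomial.coeff_monomial]
      split_ifs
      exacts [h s, zero_mem _]
  have hΦ : Function.Surjective Φ := by
    intro q
    obtain ⟨⟨r, hr⟩, rfl⟩ := Submodule.Quotient.mk_surjective _ q
    obtain ⟨P, hP, rfl⟩ := exists_isHomogeneous_of_mem_curveIdeal_pow hr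
    refine ⟨fun s => P.coeff (ε s), ?_⟩
    have hPP : Pol (fun s => P.coeff (ε s)) = P := by
      ext d
      by_cases hd : d.degree = n
      · obtain ⟨s, rfl⟩ := hεsurj d hd
        exact hcoeff _ s
      · rw [hP.coeff_eq_zero hd, (hhom _).coeff_eq_zero hd]
    exact congrArg (Submodule.Quotient.mk) (Subtype.ext
      (congrArg (MvPolynomial.aeval ![x * z - y ^ 2, x ^ 3 - y * z, y * x ^ 2 - z ^ 2]) hPP))
  have hΨ : Function.Surjective Ψ := fun q => by
    choose c hc using fun s => Submodule.Quotient.mk_surjective _ (q s)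
    exact ⟨c, funext hc⟩
  have : IsSimpleModule R (R ⧸ IsLocalRing.maximalIdeal R) :=
    isSimpleModule_iff_isCoatom.mpr (IsLocalRing.maximalIdeal.isMaximal R).out
  rw [← length_quotient_ker_eq Φ hΦ hΦker, length_quotient_ker_eq Ψ hΨ rfl,
    Module.length_pi_of_fintype]
  simp only [Module.length_eq_one, Finset.sum_const, Finset.card_univ, S]
  rw [Sym.card_sym_eq_choose, Fintype.card_fin, nsmul_one, show 3 + n - 1 = n + 2 by omega,
    Nat.choose_symm_add]

/-- Multiplication by `d` identifies `Sₙ / 𝔪Iⁿ` with `Sₙ₊₂ / Iⁿ⁺²`; filter the former by `𝔪Iⁿ ⊆ Iⁿ ⊆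
Sₙ`. -/
theorem length_curveSymbolic_quotient_add_two (hdim : ringKrullDim R = 3)
    (hm : IsLocalRing.maximalIdeal R = Ideal.span {x, y, z}) (n : ℕ) :
    Module.length R (↥(curveSymbolic x y z (n + 2)) ⧸
        (curveIdeal x y z ^ (n + 2)).submoduleOf (curveSymbolic x y z (n + 2))) =
      ((n + 2).choose 2 : ℕ) + Module.length R (↥(curveSymbolic x y z n) ⧸
        (curveIdeal x y z ^ n).submoduleOf (curveSymbolic x y z n)) := by
  let f : ↥(curveSymbolic x y z n) →ₗ[R] ↥(curveSymbolic x y z (n + 2)) ⧸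
        (curveIdeal x y z ^ (n + 2)).submoduleOf (curveSymbolic x y z (n + 2)) :=
    Submodule.mkQ _ ∘ₗ (LinearMap.mulLeft R (curveElt x y z)).restrict
      (p := curveSymbolic x y z n) (q := curveSymbolic x y z (n + 2))
      fun _ hr => curveElt_mul_mem hr
  have hf : Function.Surjective f := by
    intro q
    obtain ⟨⟨r, hr⟩, rfl⟩ := Submodule.Quotient.mk_surjective _ q
    obtain ⟨g, hg, s, hs, rfl⟩ := exists_of_mem_curveSymbolic hr
    refine ⟨⟨s, hs⟩, (Submodule.Quotient.eq _).mpr ?_⟩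
    change curveElt x y z * s - (g + curveElt x y z * s) ∈ curveIdeal x y z ^ (n + 2)
    rw [sub_add_cancel_right]
    exact neg_mem hg
  have hker : LinearMap.ker f =
      (IsLocalRing.maximalIdeal R * curveIdeal x y z ^ n).submoduleOf (curveSymbolic x y z n) := by
    ext ⟨r, hr⟩
    have : (⟨r, hr⟩ : curveSymbolic x y z n) ∈ LinearMap.ker f ↔
        curveElt x y z * r ∈ curveIdeal x y z ^ (n + 2) :=
      LinearMap.mem_ker.trans (Submodule.Quotient.mk_eq_zero _)
    rw [this]
    change _ ↔ r ∈ IsLocalRing.maximalIdeal R * curveIdeal x y z ^ n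
    constructor
    · intro h
      refine mem_of_mem_curveSymbolic_of_curveElt_pow_mul_mem (e := 1) hdim hm hr ?_
      -- The order bound `2(n + 2)` on `Iⁿ⁺²` exceeds by one the order `2n + 3` expected of `d`
      -- times a minimal generator of `Iⁿ`.
      rw [pow_one, show 3 * 1 + 2 * n + 1 = 2 * (n + 2) by ring, pow_mul]
      exact Ideal.pow_right_mono (curveIdeal_le_pow_two hm) _ h
    · exact fun h => curveElt_mul_mem_curveIdeal_pow (hm ▸ h)
  rw [← length_quotient_ker_eq f hf hker, ← length_curveIdeal_pow_quotient hdim hm n]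
  exact length_quotient_submoduleOf_add Ideal.mul_le_right (pow_le_curveSymbolic n)

theorem symbolicQuotientLength_curveIdeal (hdim : ringKrullDim R = 3)
    (hm : IsLocalRing.maximalIdeal R = Ideal.span {x, y, z}) (n : ℕ) :
    symbolicQuotientLength (curveIdeal x y z) n =
      ((∑ k ∈ Finset.Icc 1 (n / 2), (n - 2 * k + 2).choose 2 : ℕ) : ℕ∞) := by
  rw [symbolicQuotientLength, symbolicPower_curveIdeal hdim hm]
  induction n using Nat.twoStepInduction with
  | zero =>
    rw [Finset.sum_eq_zero (by simp), Nat.cast_zero, Module.length_eq_zero_iff,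
      Submodule.Quotient.subsingleton_iff, Submodule.submoduleOf_eq_top]
    rw [pow_zero, Ideal.one_eq_top]
    exact le_top
  | one =>
    rw [Finset.sum_eq_zero (by simp), Nat.cast_zero, Module.length_eq_zero_iff,
      Submodule.Quotient.subsingleton_iff, Submodule.submoduleOf_eq_top]
    exact (pow_one (curveIdeal x y z)).ge
  | more n ih _ =>
    rw [length_curveSymbolic_quotient_add_two hdim hm, ih, sum_choose_add_two, Nat.cast_add]

end Length

theorem theorem5p10 {R : Type*} [CommRing R] [IsRegularLocalRing R]
    (hdim : ringKrullDim R = 3) (x y z : R)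
    (hm : IsLocalRing.maximalIdeal R = Ideal.span {x, y, z})
    (I : Ideal R)
    (hI : I = maximalMinorsIdeal !![x, y, z; y, z, x ^ 2]) :
    (∀ n : ℕ, 1 ≤ n →
      symbolicQuotientLength I n
          = ((∑ k ∈ Finset.Icc 1 (n / 2), (n - 2 * k + 2).choose 2 : ℕ) : ℕ∞) ∧
      (Even n →
        ((symbolicQuotientLength I n).toNat : ℚ)
          = 1 / 2 * ((n + 2).choose 3 : ℚ) - 1 / 4 * ((n + 1).choose 2 : ℚ)
              - 1 / 8 * (n : ℚ)) ∧
      (Odd n →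
        ((symbolicQuotientLength I n).toNat : ℚ)
          = 1 / 2 * ((n + 2).choose 3 : ℚ) - 1 / 4 * ((n + 1).choose 2 : ℚ)
              - 1 / 8 * (n : ℚ) - 1 / 8)) ∧
    HasEpsilonMultiplicity I (1 / 2) := by
  rw [maximalMinorsIdeal_eq_curveIdeal] at hI
  subst hI
  have hlen := symbolicQuotientLength_curveIdeal hdim hm
  refine ⟨fun n _ => ⟨hlen n, fun hn => ?_, fun hn => ?_⟩, fun n _ => ?_, ?_⟩
  · rw [hlen, ENat.toNat_natCast, cast_sum_choose, if_neg (Nat.not_odd_iff_even.mpr hn), sub_zero]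
  · rw [hlen, ENat.toNat_natCast, cast_sum_choose, if_pos hn]
  · rw [hlen]
    exact ENat.natCast_ne_top _
  · simp only [hlen, ENat.toNat_natCast]
    exact tendsto_sum_choose
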